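/- Let $\alpha=\sqrt2$, $\beta=\sqrt2-1$, $\omega=\sqrt2+1$, $I=[0,\alpha]$, and $\mathbf u_m=(\cos\frac{m\pi}4,\sin\frac{m\pi}4)$. Write $[(m_1,\dots,m_n),(b_1,\dots,b_n)]$ for the open set $\{p\in\mathbb R^2:\mathbf u_{m_i}\cdot p<b_i,\ i=1,\dots,n\}$. Let $\mathtt T_{\mathbf d}$ be the translation by $\mathbf d$, $\mathtt R_n$ the rotation by $n\pi/4$ about the origin, $\mathtt U_0(x,y)=(x,-y)$, $\mathtt U_1(x,y)=(y,x)$. Let $\mathbb S=\mathbb Q(\alpha)+\mathbb Q(\alpha)s$, with $s$ an indeterminate, and let $\mathfrak G$ be the group of the isometries $\mathtt T_{\mathbf d}\mathtt R_m\mathtt U_0^n$ with $\mathbf d\in\mathbb S^2$, $0\le m\le 7$, $n\in\{0,1\}$ ($n=0$: the orientation-preserving ones, $\mathfrak G_+$). A tile is an open convex polygon $[(m_i),(b_i)]$ with all $b_i\in\mathbb S$. A dressed domain is a domain $\mathrm X$ with pairwise disjoint tiles $X_1,\dots,X_n$ (its atoms) such that $\mathrm X=\mathrm{Int}\,\overline{\bigcup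 X_i}$, and a map $\rho$ of the atoms into $\mathrm X$ which acts on each atom as an element of $\mathfrak G_+$; empty atoms are understood to be deleted. A dressed subdomain is a dressed domain whose domain lies in $\mathrm X$ and whose map is the first-return map of $\rho$ on it. An element $\mathtt G\in\mathfrak G$ carries $(\mathrm X,(X_i),\rho)$ to the congruent dressed domain $(\mathtt G\mathrm X,(\mathtt GX_i),\mathtt G\rho\mathtt G^{-1})$. Rhombus. $\mathrm R=[(0,1,4,5),(\omega,\omega,\omega,\omega)]$ has the atoms $$R_1(s)=[(0,2,5),(\omega,-1-2\alpha+\alpha\beta s,\omega)],$$ $$R_2(s)=[(0,1,2,4,5,6),(\omega,\omega,1+\alpha\beta s,\omega,\omega,1+2\alpha-\alpha\beta s)],$$ $$R_3(s)=[(1,4,6),(\omega,\omega,-1-\alpha\beta s)],$$ on which $\rho(s)$ acts as $$\rho_1(s)=\mathtt T_{(0,\,4+2\omega-2\beta s)}\mathtt R_7,\quad \rho_2(s)=\mathtt T_{(0,\,2-2\beta s)}\mathtt R_7,\quad \rho_3(s)=\mathtt T_{(0,\,-2\omega-2\beta s)}\mathtt R_7 .$$ Prototype base triangle. Let $Q_1(l)=[(6,1,3),(l,0,0)]$,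 $Q_5(l)=[(0,1,\dots,7),(l,\dots,l)]$, $Q_6(l_1,l_2)=[(5,6,0,2,3),(0,l_2,l_1,l_2,0)]$, $Q_7(l)=[(5,7,0,2),(0,l,l,0)]$, $Q_{10}(l_1,l_2)=[(4,6,0,2),(l_2,l_1,l_2,l_1)]$. The domain of $\widehat{\mathcal B}(l,h)$ is $\mathtt R_7Q_1(\alpha l+\beta h)$; its atoms are $\widehat B_i=\mathtt T_{\mathbf d_i}\mathtt R_{k_i}P_i$ and its map acts on $\widehat B_i$ as $\mathtt T_{\mathtt U_1\mathbf d_i-\mathtt R_{n_i}\mathbf d_i}\mathtt R_{n_i}$, where $$\begin{array}{c|c|c|c|c} i&P_i&k_i&\mathbf d_i&n_i\\\hline 1&Q_1(\alpha\beta l-\beta h)&2&(-\alpha\beta l+\beta h,\,-\alpha l-h)&2\\ 2&Q_7(2l-\alpha h)&0&(-2l+\alpha h,\,-2h)&3\\ 3&Q_6(2l-\beta h,\,h)&0&(-2l+\beta h,\,-h)&2\\ 4&Q_7(\alpha h)&5&(-2l+\alpha h,\,0)&1\\ 5&Q_1(\beta h)&7&(-2l,\,0)&0\end{array}$$ Proposition.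 For all $s\in I$, the atom $R_1(s)$, equipped with the return map induced by $\rho(s)$, is a dressed subdomain $\mathcal B=\mathcal B(s)$ of the dressed domain $\mathcal R(s)=(\mathrm R,(R_i(s)),\rho(s))$, and $\mathcal B$ is congruent, as a parametric dressed domain (by an element of $\mathfrak G$ that does not depend on $s\in I$ except through the indeterminate), to the prototype base triangle $\widehat{\mathcal B}(1,s)$. Up to a set of measure zero, $\mathrm R$ is the disjoint union of the tiles of the return orbits to $R_1(s)$ of the atoms $B_1,\dots,B_5$ of $\mathcal B$ and of the tiles of the periodic orbits of the three tiles $$\Pi_1=\mathtt T_{(-1-s,\,1-\beta s)}Q_{10}(s,\alpha-s),\quad \Pi_2=\mathtt T_{(-1-s,\,-\beta-\beta s)}Q_5(\alpha-s),\quad \Pi_3=\mathtt T_{(\omega-s,\,1-\beta s)}Q_5(s),$$ where each tile of these orbits lies in a single atom of $\mathcal R(s)$. For each non-empty atom $B_j$, the number of tiles of its return orbit that lie in $R_i(s)$ is the $(i,j)$ entry of the incidence matrix $$\begin{pmatrix}1&1&1&1&1\\8&2&3&4&5\\5&2&2&2&2\end{pmatrix}.$$ -/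

import Mathlib

open Set MeasureTheory

noncomputable section

namespace RhombusPWI

/-- The plane. All isometries and half-planes below are given by explicit coordinate formulae. -/
abbrev Plane : Type := ℝ × ℝ

/-- `α = √2`. -/
def α : ℝ := Real.sqrt 2

/-- `β = √2 - 1`. -/
def β : ℝ := Real.sqrt 2 - 1

/-- `ω = √2 + 1`. -/
def ω : ℝ := Real.sqrt 2 + 1

/-! ### The module `𝕊 = ℚ(√2) + ℚ(√2) s` (with `s` an indeterminate) -/

/-- The formal element `(a + b √2) + (c + d √2) s`. -/
structure SMod where
  a : ℚ
  b : ℚ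
  c : ℚ
  d : ℚ

/-- The value of an element of `𝕊` at the real parameter `s`. -/
def SMod.eval (e : SMod) (s : ℝ) : ℝ :=
  ((e.a : ℝ) + (e.b : ℝ) * α) + ((e.c : ℝ) + (e.d : ℝ) * α) * s

/-! ### Planar isometries -/

/-- The translation `T_d`. -/
def trans (d : Plane) (p : Plane) : Plane := (p.1 + d.1, p.2 + d.2)

/-- The rotation `R_n` about the origin, by the angle `n π / 4`. -/
def rot (n : ℕ) (p : Plane) : Plane :=
  (Real.cos (n * Real.pi / 4) * p.1 - Real.sin (n * Real.pi / 4) * p.2,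
   Real.sin (n * Real.pi / 4) * p.1 + Real.cos (n * Real.pi / 4) * p.2)

/-- The reflection `U_0` in the line spanned by `(1, 0)`. -/
def U0 (p : Plane) : Plane := (p.1, -p.2)

/-- The reflection `U_1` in the line spanned by `(cos (π/4), sin (π/4))`. -/
def U1 (p : Plane) : Plane := (p.2, p.1)

/-- An element `T_d R_m U_0^n` of the group `𝔊`, in canonical form: `flip` tells whether `n = 1`,
and `d ∈ 𝕊²`. -/
structure OctMotion where
  flip : Bool
  m : Fin 8
  d₁ : SMod
  d₂ : SMod

/-- The action of an element of `𝔊` on the plane, at the parameter value `s`. -/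
def OctMotion.act (g : OctMotion) (s : ℝ) (p : Plane) : Plane :=
  trans (g.d₁.eval s, g.d₂.eval s) (rot g.m (if g.flip then U0 p else p))

/-! ### Tiles -/

/-- `[(m₁, …, mₙ), (b₁, …, bₙ)]`: the intersection of the open half-planes `u_{mᵢ} · (x, y) < bᵢ`,
where `u_m = (cos (m π / 4), sin (m π / 4))`. -/
def poly (L : List (ℕ × ℝ)) : Set Plane :=
  {p | ∀ e ∈ L,
    Real.cos (e.1 * Real.pi / 4) * p.1 + Real.sin (e.1 * Real.pi / 4) * p.2 < e.2}

/-- Tiles at the parameter value `s`: open convex polygons with octagonal edge orientations and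
octagonal coordinates in `𝕊`. The empty set is allowed: it stands for a deleted tile. -/
def IsTile (s : ℝ) (X : Set Plane) : Prop :=
  Bornology.IsBounded X ∧
    ∃ L : List (ℕ × SMod), X = poly (L.map fun e => (e.1, e.2.eval s))

/-- Isosceles right triangle of height `l`. -/
def Q1 (l : ℝ) : Set Plane := poly [(6, l), (1, 0), (3, 0)]

/-- Regular octagon of inradius `l`. -/
def Q5 (l : ℝ) : Set Plane :=
  poly [(0, l), (1, l), (2, l), (3, l), (4, l), (5, l), (6, l), (7, l)]

def Q6 (l₁ l₂ : ℝ) : Set Plane := poly [(5, 0), (6, l₂), (0, l₁), (2, l₂), (3, 0)]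

def Q7 (l : ℝ) : Set Plane := poly [(5, 0), (7, l), (0, l), (2, 0)]

/-- The rectangle `|x| < l₂`, `|y| < l₁`. -/
def Q10 (l₁ l₂ : ℝ) : Set Plane := poly [(4, l₂), (6, l₁), (0, l₂), (2, l₁)]

/-! ### Dressed domains -/

/-- The data of a dressed domain: a domain, its atoms, and the domain map. Only the values
of the map on the atoms matter. -/
structure DressedDomain (ι : Type) where
  span : Set Plane
  atom : ι → Set Plane
  map : Plane → Plane

/-- The map which acts on the `i`-th atom as `iso i` (for pairwise disjoint atoms); outside the
atoms it has no meaning. -/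
def glue {ι : Type} (atom : ι → Set Plane) (iso : ι → Plane → Plane) (p : Plane) : Plane :=
  open Classical in
  if h : ∃ i, p ∈ atom i then iso h.choose p else p

/-- The data form a dressed domain at the parameter value `s`: the atoms are disjoint tiles with the
given span, the map acts on each atom as an orientation-preserving element of `𝔊`, and it maps the
atoms into the domain. -/
def IsDressedDomain {ι : Type} (s : ℝ) (X : DressedDomain ι) : Prop :=
  (∀ i, IsTile s (X.atom i)) ∧
  Pairwise (fun i j => Disjoint (X.atom i) (X.atom j)) ∧
  X.span = interior (closure (⋃ i, X.atom i)) ∧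
  (∀ i, ∃ g : OctMotion, g.flip = false ∧ EqOn X.map (g.act s) (X.atom i)) ∧
  (∀ i, MapsTo X.map (X.atom i) X.span)

/-- `n` is the first-return time of `x` to `Y`; the orbit stays in the atoms until the return. -/
def IsFirstReturnTime {ι : Type} (X : DressedDomain ι) (Y : Set Plane) (x : Plane) (n : ℕ) : Prop :=
  0 < n ∧ (∀ k < n, X.map^[k] x ∈ ⋃ i, X.atom i) ∧
  (∀ k, 0 < k → k < n → X.map^[k] x ∉ Y) ∧ X.map^[n] x ∈ Y

/-- `Y` is a dressed subdomain of `X`: both are dressed domains, `Y.span ⊆ X.span`, and the map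
of `Y` is the first-return map to `Y.span` induced by the map of `X`. -/
def IsDressedSubdomain {ι κ : Type} (s : ℝ) (X : DressedDomain ι) (Y : DressedDomain κ) : Prop :=
  IsDressedDomain s X ∧ IsDressedDomain s Y ∧ Y.span ⊆ X.span ∧
  ∀ j, ∀ x ∈ Y.atom j, ∃ n, IsFirstReturnTime X Y.span x n ∧ Y.map x = X.map^[n] x

/-- Congruence over `I` of two parametric dressed domains: a single element `g` of `𝔊` carries
`X s = (X, (Xᵢ), ρ)` to `Y s = (g X, (g Xᵢ), g ∘ ρ ∘ g⁻¹)` for all `s ∈ I`. -/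
def ParamCongruent {ι : Type} (I : Set ℝ) (X Y : ℝ → DressedDomain ι) : Prop :=
  ∃ g : OctMotion, ∀ s ∈ I,
    (Y s).span = g.act s '' (X s).span ∧
    ∀ i, (Y s).atom i = g.act s '' (X s).atom i ∧
      ∀ x ∈ (X s).atom i, (Y s).map (g.act s x) = g.act s ((X s).map x)

/-! ### Orbits of tiles -/

/-- The `k`-th iterate of a tile. -/
def orbitTile {ι : Type} (X : DressedDomain ι) (T : Set Plane) (k : ℕ) : Set Plane :=
  X.map^[k] '' T

/-- The first `n` iterates `T, ρ T, …, ρ^(n-1) T` are each contained in a single atom. -/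
def StaysInAtoms {ι : Type} (X : DressedDomain ι) (T : Set Plane) (n : ℕ) : Prop :=
  ∀ k < n, ∃ i, orbitTile X T k ⊆ X.atom i

/-- `T, ρ T, …, ρ^(n-1) T` is the return orbit to `Y` of the tile `T ⊆ Y`. -/
def IsReturnOrbit {ι : Type} (X : DressedDomain ι) (Y T : Set Plane) (n : ℕ) : Prop :=
  0 < n ∧ T ⊆ Y ∧ StaysInAtoms X T n ∧
  (∀ k, 0 < k → k < n → Disjoint (orbitTile X T k) Y) ∧ orbitTile X T n ⊆ Y

/-- `T, ρ T, …, ρ^(n-1) T` is a periodic orbit of tiles. -/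
def IsPeriodicOrbit {ι : Type} (X : DressedDomain ι) (T : Set Plane) (n : ℕ) : Prop :=
  0 < n ∧ StaysInAtoms X T n ∧ orbitTile X T n = T

/-- The number of times that the orbit `T, ρ T, …, ρ^(n-1) T` visits the atom `i`. -/
def visits {ι : Type} (X : DressedDomain ι) (T : Set Plane) (n : ℕ) (i : ι) : ℕ :=
  {k : ℕ | k < n ∧ orbitTile X T k ⊆ X.atom i}.ncard

/-- The sets `F k` are pairwise disjoint subsets of `D` and cover it up to a null set. -/
def TilesUpToNull {κ : Type} (F : κ → Set Plane) (D : Set Plane) : Prop :=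
  Pairwise (fun i j => Disjoint (F i) (F j)) ∧ (∀ k, F k ⊆ D) ∧ volume (D \ ⋃ k, F k) = 0

/-! ### The rhombus map -/

/-- The atoms `R₁(s), R₂(s), R₃(s)`, indexed by `0, 1, 2`. -/
def rhombusAtom (s : ℝ) : Fin 3 → Set Plane :=
  ![poly [(0, ω), (2, -1 - 2 * α + α * β * s), (5, ω)],
    poly [(0, ω), (1, ω), (2, 1 + α * β * s), (4, ω), (5, ω), (6, 1 + 2 * α - α * β * s)],
    poly [(1, ω), (4, ω), (6, -1 - α * β * s)]]

/-- The vertical shifts which follow the rotation by `-π/4` on the three atoms. -/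
def rhombusShift (s : ℝ) : Fin 3 → ℝ :=
  ![4 + 2 * ω - 2 * β * s, 2 - 2 * β * s, -2 * ω - 2 * β * s]

/-- The dressed rhombus `(R, (Rᵢ(s)), ρ(s))`. -/
def rhombus (s : ℝ) : DressedDomain (Fin 3) where
  span := poly [(0, ω), (1, ω), (4, ω), (5, ω)]
  atom := rhombusAtom s
  map := glue (rhombusAtom s) fun i p => trans (0, rhombusShift s i) (rot 7 p)

/-! ### The prototype base triangle -/

/-- Source polygons of the five atoms. -/
def baseShape (l h : ℝ) : Fin 5 → Set Plane :=
  ![Q1 (α * β * l - β * h), Q7 (2 * l - α * h), Q6 (2 * l - β * h) h, Q7 (α * h), Q1 (β * h)]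

/-- Rotation index of the initial placement of the atoms. -/
def basePlaceRot : Fin 5 → ℕ := ![2, 0, 0, 5, 7]

/-- Translation vector of the initial placement of the atoms. -/
def baseAnchor (l h : ℝ) : Fin 5 → Plane :=
  ![(-α * β * l + β * h, -α * l - h), (-2 * l + α * h, -2 * h), (-2 * l + β * h, -h),
    (-2 * l + α * h, 0), (-2 * l, 0)]

/-- Rotation index of the map on the atoms. -/
def baseMapRot : Fin 5 → ℕ := ![2, 3, 2, 1, 0]

/-- The atoms `T_d R_n Q`. -/
def baseAtom (l h : ℝ) (i : Fin 5) : Set Plane :=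
  (fun p => trans (baseAnchor l h i) (rot (basePlaceRot i) p)) '' baseShape l h i

/-- The isometry `T_{U₁ d - R_n d} R_n`: the rotation part is `R_n`, and the anchor point `d` of the
atom goes to `U₁ d`. -/
def baseIso (l h : ℝ) (i : Fin 5) (p : Plane) : Plane :=
  trans (U1 (baseAnchor l h i) - rot (baseMapRot i) (baseAnchor l h i)) (rot (baseMapRot i) p)

/-- The prototype base triangle `B̂(l, h)`. -/
def baseTriangle (l h : ℝ) : DressedDomain (Fin 5) where
  span := rot 7 '' Q1 (α * l + β * h)
  atom := baseAtom l h
  map := glue (baseAtom l h) (baseIso l h)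

/-! ### Periodic tiles and the incidence matrix -/

/-- The periodic tiles `Π₁, Π₂, Π₃`, indexed by `0, 1, 2`. -/
def periodicTile (s : ℝ) : Fin 3 → Set Plane :=
  ![trans (-1 - s, 1 - β * s) '' Q10 s (α - s),
    trans (-1 - s, -β - β * s) '' Q5 (α - s),
    trans (ω - s, 1 - β * s) '' Q5 s]

/-- Row `i`, column `j`: number of visits to the rhombus atom `i` of the return orbit of the base
triangle atom `j`. -/
def incidence : Matrix (Fin 3) (Fin 5) ℕ :=
  !![1, 1, 1, 1, 1;
     8, 2, 3, 4, 5;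
     5, 2, 2, 2, 2]

end RhombusPWI

end

open RhombusPWI

noncomputable section

namespace RhombusPWI

/-! ### Octagonal coordinates -/

/-! Every polygon in play has edges normal to the eight vectors `u_m`, so it is an intersection of
eight half-planes `u_m · p < h m`. On such bounds an octagonal rotation permutes the indices
cyclically and a translation adds a vector, so `ρ(s)` on a tile becomes `Support.step`: an index
shift plus a known addend. All bounds are affine in `s` with coefficients in `ℤ[√2]`. An inequality
between them holds on `[0, √2]` as soon as it holds at both endpoints, where it is a sign question
for `a + b√2`, decidable on integers. Itineraries, first returns, periodicity, incidence numbers and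
disjointness of the 48 orbit tiles are thus finite computations (`returnSupport_follows`,
`periodicSupport_follows`, `returnSupport_separated`, `tileSupport_separated`), uniform in `s`;
tiles that degenerate to the empty set at an endpoint need no separate case there.

Exhaustion of the rhombus is an area count (`tileSupport_cover`): disjoint tiles inside the rhombus,
whose areas are at least numbers that sum to `4αω²`, leave a null set. The same fact gives the spans
of both dressed domains (`eq_interior_closure_of_volume_eq_zero`). Finally the return isometries are
read off by iterating zero bounds (`Support.Follows.dir_iterate`) and matched with the translated
prototype (`baseShift_add_eq`). -/

theorem α_sq : α ^ 2 = 2 := Real.sq_sqrt (by norm_num)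

theorem α_mul_α_mul (t : ℝ) : α * (α * t) = 2 * t := by
  linear_combination t * α_sq

theorem α_pos : 0 < α := Real.sqrt_pos.2 (by norm_num)

/-- The octagonal coordinate `u_m · p`. -/
def dir (m : ℕ) (p : Plane) : ℝ :=
  Real.cos (m * Real.pi / 4) * p.1 + Real.sin (m * Real.pi / 4) * p.2

theorem dir_add_four (m : ℕ) (p : Plane) : dir (m + 4) p = -dir m p := by
  have h : ((m + 4 : ℕ) : ℝ) * Real.pi / 4 = m * Real.pi / 4 + Real.pi := by
    push_cast; ring
  simp only [dir, h, Real.cos_add_pi, Real.sin_add_pi]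
  ring

theorem dir_add_eight (m : ℕ) (p : Plane) : dir (m + 8) p = dir m p := by
  rw [show m + 8 = m + 4 + 4 by ring, dir_add_four, dir_add_four, neg_neg]

theorem dir_add_mul_eight (m k : ℕ) (p : Plane) : dir (m + 8 * k) p = dir m p := by
  induction k with
  | zero => rfl
  | succ k ih => rw [mul_add, mul_one, ← add_assoc, dir_add_eight, ih]

theorem dir_mod_eight (m : ℕ) (p : Plane) : dir (m % 8) p = dir m p := by
  conv_rhs => rw [← Nat.mod_add_div m 8, dir_add_mul_eight]

theorem dir_add_rot (m n : ℕ) (p : Plane) : dir (m + n) (rot n p) = dir m p := by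
  have h : ((m + n : ℕ) : ℝ) * Real.pi / 4 = m * Real.pi / 4 + n * Real.pi / 4 := by
    push_cast; ring
  simp only [dir, rot, h, Real.cos_add, Real.sin_add]
  linear_combination
    (Real.cos (m * Real.pi / 4) * p.1 + Real.sin (m * Real.pi / 4) * p.2) *
      Real.sin_sq_add_cos_sq (n * Real.pi / 4)

theorem dir_val_add (m : Fin 8) (n : ℕ) (p : Plane) :
    dir ((m + Fin.ofNat 8 n : Fin 8) : ℕ) p = dir (m + n) p := by
  rw [Fin.val_add, Fin.val_ofNat, dir_mod_eight, ← dir_mod_eight, Nat.add_mod_mod, dir_mod_eight]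

theorem dir_val_rot (m : Fin 8) (n : ℕ) (p : Plane) :
    dir m (rot n p) = dir ((m - Fin.ofNat 8 n : Fin 8) : ℕ) p := by
  rw [← dir_add_rot ((m - Fin.ofNat 8 n : Fin 8) : ℕ) n p, ← dir_val_add, sub_add_cancel]

theorem dir_trans (m : ℕ) (d p : Plane) : dir m (trans d p) = dir m p + dir m d := by
  simp only [dir, trans]; ring

theorem dir_sub (m : ℕ) (p q : Plane) : dir m (p - q) = dir m p - dir m q := by
  simp only [dir, Prod.fst_sub, Prod.snd_sub]; ring

theorem dir_zero (p : Plane) : dir 0 p = p.1 := by simp [dir]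

theorem dir_one (p : Plane) : dir 1 p = α / 2 * (p.1 + p.2) := by
  simp only [dir, Nat.cast_one, one_mul, Real.cos_pi_div_four, Real.sin_pi_div_four, α]; ring

theorem dir_two (p : Plane) : dir 2 p = p.2 := by
  have h : ((2 : ℕ) : ℝ) * Real.pi / 4 = Real.pi / 2 := by push_cast; ring
  simp only [dir, h, Real.cos_pi_div_two, Real.sin_pi_div_two]; ring

theorem dir_three (p : Plane) : dir 3 p = α / 2 * (p.2 - p.1) := by
  have h : ((3 : ℕ) : ℝ) * Real.pi / 4 = Real.pi / 4 + Real.pi / 2 := by push_cast; ring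
  simp only [dir, h, Real.cos_add_pi_div_two, Real.sin_add_pi_div_two, Real.cos_pi_div_four,
    Real.sin_pi_div_four, α]
  ring

theorem dir_four (p : Plane) : dir 4 p = -p.1 := by rw [dir_add_four 0, dir_zero]

theorem dir_five (p : Plane) : dir 5 p = -(α / 2 * (p.1 + p.2)) := by
  rw [dir_add_four 1, dir_one]

theorem dir_six (p : Plane) : dir 6 p = -p.2 := by rw [dir_add_four 2, dir_two]

theorem dir_seven (p : Plane) : dir 7 p = -(α / 2 * (p.2 - p.1)) := by
  rw [dir_add_four 3, dir_three]

/-- Diagonal coordinates carry the factor `1/√2 = α/2`; multiplying by `α` clears it, which leaves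
inequalities linear in `p.1` and `p.2`. -/
theorem mul_half_lt_iff {x b : ℝ} : α / 2 * x < b ↔ x < α * b := by
  rw [← mul_lt_mul_iff_right₀ α_pos, show α * (α / 2 * x) = x by linear_combination x / 2 * α_sq]

theorem dir_one_lt {p : Plane} {b : ℝ} : dir 1 p < b ↔ p.1 + p.2 < α * b := by
  rw [dir_one, mul_half_lt_iff]

theorem dir_three_lt {p : Plane} {b : ℝ} : dir 3 p < b ↔ p.2 - p.1 < α * b := by
  rw [dir_three, mul_half_lt_iff]

theorem dir_five_lt {p : Plane} {b : ℝ} : dir 5 p < b ↔ -(p.1 + p.2) < α * b := by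
  rw [dir_five, ← mul_neg, mul_half_lt_iff]

theorem dir_seven_lt {p : Plane} {b : ℝ} : dir 7 p < b ↔ p.1 - p.2 < α * b := by
  rw [dir_seven, ← mul_neg, neg_sub, mul_half_lt_iff]

/-! ### Octagons -/

/-- The polygon with octagonal edge orientations given by all eight bounds. -/
def octagon (h : Fin 8 → ℝ) : Set Plane := {p | ∀ m : Fin 8, dir m p < h m}

theorem trans_image_octagon (d : Plane) (h : Fin 8 → ℝ) :
    trans d '' octagon h = octagon fun m => h m + dir m d := by
  ext y
  constructor
  · rintro ⟨p, hp, rfl⟩ m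
    rw [dir_trans]
    linarith [hp m]
  · intro hy
    refine ⟨y - d, fun m => ?_, by simp [trans]⟩
    rw [dir_sub]
    linarith [hy m]

theorem rot_surjective (n : ℕ) : Function.Surjective (rot n) := by
  intro y
  refine ⟨(Real.cos (n * Real.pi / 4) * y.1 + Real.sin (n * Real.pi / 4) * y.2,
    -Real.sin (n * Real.pi / 4) * y.1 + Real.cos (n * Real.pi / 4) * y.2), ?_⟩
  have h := Real.sin_sq_add_cos_sq (n * Real.pi / 4)
  ext <;> simp only [rot]
  · linear_combination y.1 * h
  · linear_combination y.2 * h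

/-- This is why all eight bounds are stored, redundant ones included: the family of octagons is then
closed under rotation, which only shifts indices. -/
theorem rot_image_octagon (n : ℕ) (h : Fin 8 → ℝ) :
    rot n '' octagon h = octagon fun m => h (m - Fin.ofNat 8 n) := by
  ext y
  constructor
  · rintro ⟨p, hp, rfl⟩ m
    rw [dir_val_rot]
    exact hp _
  · intro hy
    obtain ⟨p, rfl⟩ := rot_surjective n y
    refine ⟨p, fun m => ?_, rfl⟩
    have := hy (m + Fin.ofNat 8 n)
    simpa only [dir_val_rot, add_sub_cancel_right] using this

theorem mem_octagon_cons {p : Plane} {h : Fin 8 → ℝ} : p ∈ octagon h ↔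
    p.1 < h 0 ∧ p.1 + p.2 < α * h 1 ∧ p.2 < h 2 ∧ p.2 - p.1 < α * h 3 ∧ -p.1 < h 4 ∧
      -(p.1 + p.2) < α * h 5 ∧ -p.2 < h 6 ∧ p.1 - p.2 < α * h 7 := by
  rw [← dir_one_lt, ← dir_three_lt, ← dir_five_lt, ← dir_seven_lt, ← dir_four, ← dir_six,
    ← dir_zero, ← dir_two]
  constructor
  · intro hp
    exact ⟨hp 0, hp 1, hp 2, hp 3, hp 4, hp 5, hp 6, hp 7⟩
  · rintro ⟨h0, h1, h2, h3, h4, h5, h6, h7⟩ m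
    fin_cases m <;> assumption

theorem mem_poly {p : Plane} {L : List (ℕ × ℝ)} : p ∈ poly L ↔ ∀ e ∈ L, dir e.1 p < e.2 := Iff.rfl

theorem octagon_eq_poly (h : Fin 8 → ℝ) :
    octagon h = poly (List.ofFn fun m : Fin 8 => ((m : ℕ), h m)) := by
  ext p
  simp only [mem_poly, List.forall_mem_ofFn_iff]
  rfl

theorem isOpen_octagon (h : Fin 8 → ℝ) : IsOpen (octagon h) := by
  simp only [octagon, ofPred_forall]
  refine isOpen_iInter_of_finite fun m => isOpen_lt ?_ continuous_const
  unfold dir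
  fun_prop

theorem convex_octagon (h : Fin 8 → ℝ) : Convex ℝ (octagon h) := by
  simp only [octagon, ofPred_forall]
  refine convex_iInter fun m => convex_halfSpace_lt ⟨fun p q => ?_, fun c p => ?_⟩ _
  · simp only [dir, Prod.fst_add, Prod.snd_add]; ring
  · simp only [dir, Prod.smul_fst, Prod.smul_snd, smul_eq_mul]; ring

theorem isBounded_octagon (h : Fin 8 → ℝ) : Bornology.IsBounded (octagon h) := by
  refine (Metric.isBounded_Icc (-h 4) (h 0) |>.prod (Metric.isBounded_Icc (-h 6) (h 2))).subset ?_
  intro p hp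
  rw [mem_octagon_cons] at hp
  exact ⟨⟨by linarith, by linarith⟩, ⟨by linarith, by linarith⟩⟩

/-- Since `u_{m+4} = -u_m`, the two bounds confine `u_m · p` to opposite sides of a strip of
nonpositive width. -/
theorem disjoint_octagon {h k : Fin 8 → ℝ} (m : Fin 8) (hm : h m + k (m + 4) ≤ 0) :
    Disjoint (octagon h) (octagon k) := by
  rw [Set.disjoint_left]
  intro p hp hp'
  have h1 := hp m
  have h2 := hp' (m + 4)
  rw [show m + 4 = m + Fin.ofNat 8 4 from rfl, dir_val_add, dir_add_four] at h2
  have : h m + k (m + Fin.ofNat 8 4) ≤ 0 := hm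
  linarith

/-! ### Redundant edges -/

/-- Reduces an equality of polygons to linear inequalities in Cartesian coordinates. -/
theorem poly_eq_octagon_iff {L : List (ℕ × ℝ)} {h : Fin 8 → ℝ} : poly L = octagon h ↔
    ∀ p : Plane, (∀ e ∈ L, dir e.1 p < e.2) ↔
      p.1 < h 0 ∧ p.1 + p.2 < α * h 1 ∧ p.2 < h 2 ∧ p.2 - p.1 < α * h 3 ∧ -p.1 < h 4 ∧
      -(p.1 + p.2) < α * h 5 ∧ -p.2 < h 6 ∧ p.1 - p.2 < α * h 7 := by
  simp only [Set.ext_iff, mem_poly, mem_octagon_cons]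

theorem α_mul_half_mul (t : ℝ) : α * (α / 2 * t) = t := by linear_combination t / 2 * α_sq

set_option linter.unusedSimpArgs false

/-- Each missing normal is a nonnegative combination of the given ones, for instance `u_3 = α u_2 +
u_5`; the same combination of bounds gives the redundant edge. The other conversions below follow
this pattern. -/
theorem poly_zero_two_five (a b c : ℝ) : poly [(0, a), (2, b), (5, c)] =
    octagon ![a, α / 2 * (a + b), b, α * b + c, b + α * c, c, a + α * c, α * a + c] := by
  refine poly_eq_octagon_iff.2 fun p => ?_
  simp only [List.forall_mem_cons, List.not_mem_nil, IsEmpty.forall_iff, implies_true, and_true,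
    dir_zero, dir_one_lt, dir_two, dir_three_lt, dir_four, dir_five_lt, dir_six, dir_seven_lt,
    Matrix.cons_val, mul_add, mul_zero, α_mul_α_mul, α_mul_half_mul]
  constructor <;> intro h <;> casesm* _ ∧ _ <;> split_ands <;> linarith

theorem poly_one_four_six (a b c : ℝ) : poly [(1, a), (4, b), (6, c)] =
    octagon ![α * a + c, a, α * a + b, a + α * b, b, α / 2 * (b + c), c, a + α * c] := by
  refine poly_eq_octagon_iff.2 fun p => ?_
  simp only [List.forall_mem_cons, List.not_mem_nil, IsEmpty.forall_iff, implies_true, and_true,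
    dir_zero, dir_one_lt, dir_two, dir_three_lt, dir_four, dir_five_lt, dir_six, dir_seven_lt,
    Matrix.cons_val, mul_add, mul_zero, α_mul_α_mul, α_mul_half_mul]
  constructor <;> intro h <;> casesm* _ ∧ _ <;> split_ands <;> linarith

theorem poly_zero_one_two_four_five_six (a b c d e f : ℝ) :
    poly [(0, a), (1, b), (2, c), (4, d), (5, e), (6, f)] =
    octagon ![a, b, c, α / 2 * (c + d), d, e, f, α / 2 * (f + a)] := by
  refine poly_eq_octagon_iff.2 fun p => ?_
  simp only [List.forall_mem_cons, List.not_mem_nil, IsEmpty.forall_iff, implies_true, and_true,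
    dir_zero, dir_one_lt, dir_two, dir_three_lt, dir_four, dir_five_lt, dir_six, dir_seven_lt,
    Matrix.cons_val, mul_add, mul_zero, α_mul_α_mul, α_mul_half_mul]
  constructor <;> intro h <;> casesm* _ ∧ _ <;> split_ands <;> linarith

theorem poly_zero_one_four_five (a b c d : ℝ) : poly [(0, a), (1, b), (4, c), (5, d)] =
    octagon ![a, b, α * b + c, b + α * c, c, d, α * d + a, d + α * a] := by
  refine poly_eq_octagon_iff.2 fun p => ?_
  simp only [List.forall_mem_cons, List.not_mem_nil, IsEmpty.forall_iff, implies_true, and_true,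
    dir_zero, dir_one_lt, dir_two, dir_three_lt, dir_four, dir_five_lt, dir_six, dir_seven_lt,
    Matrix.cons_val, mul_add, mul_zero, α_mul_α_mul, α_mul_half_mul]
  constructor <;> intro h <;> casesm* _ ∧ _ <;> split_ands <;> linarith

theorem Q1_eq_octagon (l : ℝ) : Q1 l =
    octagon ![l, 0, 0, 0, l, α * l, l, α * l] := by
  refine poly_eq_octagon_iff.2 fun p => ?_
  simp only [List.forall_mem_cons, List.not_mem_nil, IsEmpty.forall_iff, implies_true, and_true,
    dir_zero, dir_one_lt, dir_two, dir_three_lt, dir_four, dir_five_lt, dir_six, dir_seven_lt,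
    Matrix.cons_val, mul_add, mul_zero, α_mul_α_mul, α_mul_half_mul]
  constructor <;> intro h <;> casesm* _ ∧ _ <;> split_ands <;> linarith

theorem Q6_eq_octagon (a b : ℝ) : Q6 a b =
    octagon ![a, α / 2 * (a + b), b, 0, 0, 0, b, α / 2 * (a + b)] := by
  refine poly_eq_octagon_iff.2 fun p => ?_
  simp only [List.forall_mem_cons, List.not_mem_nil, IsEmpty.forall_iff, implies_true, and_true,
    dir_zero, dir_one_lt, dir_two, dir_three_lt, dir_four, dir_five_lt, dir_six, dir_seven_lt,
    Matrix.cons_val, mul_add, mul_zero, α_mul_α_mul, α_mul_half_mul]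
  constructor <;> intro h <;> casesm* _ ∧ _ <;> split_ands <;> linarith

theorem Q7_eq_octagon (l : ℝ) : Q7 l =
    octagon ![l, α / 2 * l, 0, 0, 0, 0, α / 2 * l, l] := by
  refine poly_eq_octagon_iff.2 fun p => ?_
  simp only [List.forall_mem_cons, List.not_mem_nil, IsEmpty.forall_iff, implies_true, and_true,
    dir_zero, dir_one_lt, dir_two, dir_three_lt, dir_four, dir_five_lt, dir_six, dir_seven_lt,
    Matrix.cons_val, mul_add, mul_zero, α_mul_α_mul, α_mul_half_mul]
  constructor <;> intro h <;> casesm* _ ∧ _ <;> split_ands <;> linarith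

theorem Q10_eq_octagon (a b : ℝ) : Q10 a b =
    octagon ![b, α / 2 * (a + b), a, α / 2 * (a + b), b, α / 2 * (a + b), a, α / 2 * (a + b)] := by
  refine poly_eq_octagon_iff.2 fun p => ?_
  simp only [List.forall_mem_cons, List.not_mem_nil, IsEmpty.forall_iff, implies_true, and_true,
    dir_zero, dir_one_lt, dir_two, dir_three_lt, dir_four, dir_five_lt, dir_six, dir_seven_lt,
    Matrix.cons_val, mul_add, mul_zero, α_mul_α_mul, α_mul_half_mul]
  constructor <;> intro h <;> casesm* _ ∧ _ <;> split_ands <;> linarith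

theorem Q5_eq_octagon (l : ℝ) : Q5 l = octagon fun _ => l := by
  rw [octagon_eq_poly]
  rfl

/-! ### Exact arithmetic with parameter-dependent bounds -/

/-- The element `(a + b √2) + (c + d √2) s` of `𝕊` with integer coefficients. -/
structure ZAff where
  a : ℤ
  b : ℤ
  c : ℤ
  d : ℤ
deriving DecidableEq

namespace ZAff

def eval (e : ZAff) (s : ℝ) : ℝ := ((e.a : ℝ) + e.b * α) + ((e.c : ℝ) + e.d * α) * s

def toSMod (e : ZAff) : SMod := ⟨e.a, e.b, e.c, e.d⟩

theorem eval_toSMod (e : ZAff) (s : ℝ) : e.toSMod.eval s = e.eval s := by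
  simp [toSMod, SMod.eval, eval]

instance : Add ZAff := ⟨fun e f => ⟨e.a + f.a, e.b + f.b, e.c + f.c, e.d + f.d⟩⟩

theorem eval_add (e f : ZAff) (s : ℝ) : (e + f).eval s = e.eval s + f.eval s := by
  change (⟨e.a + f.a, e.b + f.b, e.c + f.c, e.d + f.d⟩ : ZAff).eval s = _
  simp only [eval]
  push_cast
  ring

/-- A decision procedure for `0 ≤ a + b √2`. -/
def SqrtNonneg (a b : ℤ) : Prop :=
  0 ≤ a ∧ 0 ≤ b ∨ 0 ≤ a ∧ 2 * (b * b) ≤ a * a ∨ 0 ≤ b ∧ a * a ≤ 2 * (b * b)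

instance (a b : ℤ) : Decidable (SqrtNonneg a b) := by unfold SqrtNonneg; infer_instance

/-- Only soundness is used. In the last two cases the nonnegative term dominates the other in
absolute value, by comparison of squares. -/
theorem SqrtNonneg.nonneg {a b : ℤ} (h : SqrtNonneg a b) : 0 ≤ (a : ℝ) + b * α := by
  have hα := α_pos
  have hsq := α_sq
  rcases h with ⟨ha, hb⟩ | ⟨ha, hab⟩ | ⟨hb, hab⟩
  · have ha' : (0 : ℝ) ≤ a := by exact_mod_cast ha
    have hb' : (0 : ℝ) ≤ b := by exact_mod_cast hb
    positivity
  · have ha' : (0 : ℝ) ≤ a := by exact_mod_cast ha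
    have hab' : 2 * ((b : ℝ) * b) ≤ a * a := by exact_mod_cast hab
    have : |-(b * α)| ≤ (a : ℝ) := abs_le_of_sq_le_sq (by nlinarith) ha'
    linarith [le_abs_self (-(b * α))]
  · have hb' : (0 : ℝ) ≤ b := by exact_mod_cast hb
    have hab' : (a : ℝ) * a ≤ 2 * (b * b) := by exact_mod_cast hab
    have : |-(a : ℝ)| ≤ b * α := abs_le_of_sq_le_sq (by nlinarith) (by positivity)
    linarith [le_abs_self (-(a : ℝ))]

/-- `e ≤ f` at both endpoints of the parameter interval `[0, √2]`. -/
def Le (e f : ZAff) : Prop :=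
  SqrtNonneg (f.a - e.a) (f.b - e.b) ∧
    SqrtNonneg (f.a - e.a + 2 * (f.d - e.d)) (f.b - e.b + (f.c - e.c))

instance (e f : ZAff) : Decidable (Le e f) := by unfold Le; infer_instance

/-- An affine function of `s` that is nonnegative at `0` and at `√2` is nonnegative in between. At
`s = √2` the value is `(a + 2d) + (b + c)√2`. -/
theorem Le.eval_le {e f : ZAff} (h : Le e f) {s : ℝ} (hs : s ∈ Icc 0 α) :
    e.eval s ≤ f.eval s := by
  have h0 := h.1.nonneg
  have h1 := h.2.nonneg
  have hα := α_pos
  push_cast at h0 h1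
  -- Interpolation between the endpoint values, multiplied by the interval length `α` to avoid
  -- division.
  have key : α * (f.eval s - e.eval s) =
      (α - s) * ((f.a - e.a : ℝ) + (f.b - e.b) * α) +
        s * ((f.a - e.a + 2 * (f.d - e.d) : ℝ) + (f.b - e.b + (f.c - e.c)) * α) := by
    simp only [eval]
    linear_combination (f.d - e.d : ℝ) * s * α_sq
  have : 0 ≤ α * (f.eval s - e.eval s) := by
    rw [key]
    exact add_nonneg (mul_nonneg (by linarith [hs.2]) h0) (mul_nonneg hs.1 h1)
  linarith [nonneg_of_mul_nonneg_right this hα]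

/-- `e + f ≤ 0` at both endpoints of the parameter interval. -/
theorem eval_add_nonpos {e f : ZAff} (h : Le (e + f) ⟨0, 0, 0, 0⟩) {s : ℝ} (hs : s ∈ Icc 0 α) :
    e.eval s + f.eval s ≤ 0 := by
  have := h.eval_le hs
  rw [eval_add] at this
  simpa [eval] using this

end ZAff

/-- The bounds in the eight octagonal directions of a parametric tile. -/
abbrev Support : Type := Fin 8 → ZAff

namespace Support

/-- The tile with the given bounds, at the parameter value `s`. -/
def tile (H : Support) (s : ℝ) : Set Plane := octagon fun m => (H m).eval s

/-- A sufficient condition for inclusion over the parameter interval. -/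
def Le (H K : Support) : Prop := ∀ m, (H m).Le (K m)

instance (H K : Support) : Decidable (Le H K) := by unfold Le; infer_instance

theorem Le.subset {H K : Support} (h : H.Le K) {s : ℝ} (hs : s ∈ Icc 0 α) :
    H.tile s ⊆ K.tile s :=
  fun _ hp m => (hp m).trans_le ((h m).eval_le hs)

/-- An edge of one of the tiles separates them over the parameter interval. -/
def Separated (H K : Support) : Prop := ∃ m, (H m + K (m + 4)).Le ⟨0, 0, 0, 0⟩

instance (H K : Support) : Decidable (Separated H K) := by unfold Separated; infer_instance

theorem Separated.disjoint {H K : Support} (h : H.Separated K) {s : ℝ} (hs : s ∈ Icc 0 α) :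
    Disjoint (H.tile s) (K.tile s) := by
  obtain ⟨m, hm⟩ := h
  exact disjoint_octagon m (ZAff.eval_add_nonpos hm hs)

theorem isTile (H : Support) (s : ℝ) : IsTile s (H.tile s) := by
  refine ⟨isBounded_octagon _, List.ofFn fun m : Fin 8 => ((m : ℕ), (H m).toSMod), ?_⟩
  rw [tile, octagon_eq_poly, List.map_ofFn]
  simp only [Function.comp_def, ZAff.eval_toSMod]

theorem isOpen_tile (H : Support) (s : ℝ) : IsOpen (H.tile s) := isOpen_octagon _

/-- An octagon whose bounds are the values of elements of `𝕊` is a parametric tile. -/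
theorem octagon_eq_tile {h : Fin 8 → ℝ} {H : Support} {s : ℝ} (hH : ∀ m, h m = (H m).eval s) :
    octagon h = H.tile s := by
  rw [tile, funext hH]

end Support

/-! ### The rhombus map on tiles -/

/-- The given edges have the bound `ω = 1 + √2`, the redundant ones `ω + αω = 3 + 2√2`. -/
def rhombusSupport : Support :=
  ![⟨1, 1, 0, 0⟩, ⟨1, 1, 0, 0⟩, ⟨3, 2, 0, 0⟩, ⟨3, 2, 0, 0⟩,
      ⟨1, 1, 0, 0⟩, ⟨1, 1, 0, 0⟩, ⟨3, 2, 0, 0⟩, ⟨3, 2, 0, 0⟩]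

def rhombusAtomSupport : Fin 3 → Support :=
  ![![⟨1, 1, 0, 0⟩, ⟨-1, 0, -1, 1⟩, ⟨-1, -2, 2, -1⟩, ⟨-3, 0, -2, 2⟩,
      ⟨1, -1, 2, -1⟩, ⟨1, 1, 0, 0⟩, ⟨3, 2, 0, 0⟩, ⟨3, 2, 0, 0⟩],
    ![⟨1, 1, 0, 0⟩, ⟨1, 1, 0, 0⟩, ⟨1, 0, 2, -1⟩, ⟨1, 1, -1, 1⟩,
      ⟨1, 1, 0, 0⟩, ⟨1, 1, 0, 0⟩, ⟨1, 2, -2, 1⟩, ⟨3, 1, 1, -1⟩],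
    ![⟨1, 1, -2, 1⟩, ⟨1, 1, 0, 0⟩, ⟨3, 2, 0, 0⟩, ⟨3, 2, 0, 0⟩,
      ⟨1, 1, 0, 0⟩, ⟨1, 0, 1, -1⟩, ⟨-1, 0, -2, 1⟩, ⟨1, 0, 2, -2⟩]]

/-- The octagonal coordinates of the shift vectors. -/
def shiftSupport : Fin 3 → Support :=
  ![![⟨0, 0, 0, 0⟩, ⟨2, 3, -2, 1⟩, ⟨6, 2, 2, -2⟩, ⟨2, 3, -2, 1⟩,
      ⟨0, 0, 0, 0⟩, ⟨-2, -3, 2, -1⟩, ⟨-6, -2, -2, 2⟩, ⟨-2, -3, 2, -1⟩],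
    ![⟨0, 0, 0, 0⟩, ⟨0, 1, -2, 1⟩, ⟨2, 0, 2, -2⟩, ⟨0, 1, -2, 1⟩,
      ⟨0, 0, 0, 0⟩, ⟨0, -1, 2, -1⟩, ⟨-2, 0, -2, 2⟩, ⟨0, -1, 2, -1⟩],
    ![⟨0, 0, 0, 0⟩, ⟨-2, -1, -2, 1⟩, ⟨-2, -2, 2, -2⟩, ⟨-2, -1, -2, 1⟩,
      ⟨0, 0, 0, 0⟩, ⟨2, 1, 2, -1⟩, ⟨2, 2, -2, 2⟩, ⟨2, 1, 2, -1⟩]]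

theorem rhombus_span (s : ℝ) : (rhombus s).span = rhombusSupport.tile s := by
  simp only [rhombus, poly_zero_one_four_five]
  refine Support.octagon_eq_tile fun m => ?_
  have := α_sq
  fin_cases m <;> simp [rhombusSupport, ZAff.eval, ω, α] <;> grind

theorem rhombusAtom_eq (s : ℝ) (i : Fin 3) : rhombusAtom s i = (rhombusAtomSupport i).tile s := by
  have h := α_sq
  have hβ : β = α - 1 := rfl
  have hω : ω = α + 1 := rfl
  fin_cases i <;> simp only [rhombusAtom, Fin.zero_eta, Fin.mk_one, Fin.reduceFinMk, Matrix.cons_val,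
    poly_zero_two_five, poly_zero_one_two_four_five_six, poly_one_four_six] <;>
  refine Support.octagon_eq_tile fun m => ?_ <;> rw [hβ, hω] <;>
  fin_cases m <;> simp [rhombusAtomSupport, ZAff.eval] <;> grind

theorem dir_shift (s : ℝ) (i : Fin 3) (m : Fin 8) :
    dir m (0, rhombusShift s i) = (shiftSupport i m).eval s := by
  have h := α_sq
  have hβ : β = α - 1 := rfl
  have hω : ω = α + 1 := rfl
  fin_cases i <;> fin_cases m <;>
    simp [dir_zero, dir_one, dir_two, dir_three, dir_four, dir_five, dir_six, dir_seven,
      rhombusShift, shiftSupport, ZAff.eval, hβ, hω] <;> grind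

/-- Disjointness of the atoms makes the choice in `glue` unambiguous. -/
theorem glue_apply {ι : Type} {atom : ι → Set Plane} (iso : ι → Plane → Plane)
    (hd : Pairwise fun i j => Disjoint (atom i) (atom j)) {i : ι} {p : Plane} (hp : p ∈ atom i) :
    glue atom iso p = iso i p := by
  have h : ∃ i, p ∈ atom i := ⟨i, hp⟩
  have hi : h.choose = i := by
    by_contra hne
    exact Set.disjoint_left.1 (hd hne) h.choose_spec hp
  rw [glue, dif_pos h, hi]

theorem rhombusAtomSupport_separated :
    ∀ i j, i ≠ j → (rhombusAtomSupport i).Separated (rhombusAtomSupport j) := by decide +kernel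

theorem rhombusAtom_disjoint {s : ℝ} (hs : s ∈ Icc 0 α) :
    Pairwise fun i j => Disjoint (rhombusAtom s i) (rhombusAtom s j) := by
  intro i j hij
  rw [rhombusAtom_eq, rhombusAtom_eq]
  exact (rhombusAtomSupport_separated i j hij).disjoint hs

theorem rhombus_map_apply {s : ℝ} (hs : s ∈ Icc 0 α) {i : Fin 3} {p : Plane}
    (hp : p ∈ (rhombusAtomSupport i).tile s) :
    (rhombus s).map p = trans (0, rhombusShift s i) (rot 7 p) :=
  glue_apply (fun i p => trans (0, rhombusShift s i) (rot 7 p)) (rhombusAtom_disjoint hs)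
    (by rwa [rhombusAtom_eq])

theorem sub_ofNat_seven (m : Fin 8) : m - Fin.ofNat 8 7 = m + 1 := by
  revert m; decide

/-- `R_7` turns by `-π/4`, so the coordinate `m` of the image is the coordinate `m + 1` of the
source, up to the shift. -/
theorem dir_rhombus_map {s : ℝ} (hs : s ∈ Icc 0 α) {i : Fin 3} {p : Plane}
    (hp : p ∈ (rhombusAtomSupport i).tile s) (m : Fin 8) :
    dir m ((rhombus s).map p) = dir ((m + 1 : Fin 8) : ℕ) p + (shiftSupport i m).eval s := by
  rw [rhombus_map_apply hs hp, dir_trans, dir_val_rot, dir_shift, sub_ofNat_seven]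

namespace Support

/-- The bounds of the image of a tile in the `i`-th atom of the rhombus. -/
def step (i : Fin 3) (H : Support) : Support := fun m => H (m + 1) + shiftSupport i m

/-- The bounds of the `k`-th image of a tile which visits the atoms `c 0, c 1, …`. -/
def iter (c : ℕ → Fin 3) (H : Support) : ℕ → Support
  | 0 => H
  | k + 1 => step (c k) (iter c H k)

/-- The first `n` tiles in the orbit of `H` lie in the atoms prescribed by `c`. -/
def Follows (c : ℕ → Fin 3) (H : Support) (n : ℕ) : Prop :=
  ∀ k < n, (iter c H k).Le (rhombusAtomSupport (c k))

instance (c : ℕ → Fin 3) (H : Support) (n : ℕ) : Decidable (Follows c H n) := by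
  unfold Follows; infer_instance

variable {s : ℝ} {c : ℕ → Fin 3} {H : Support} {n k : ℕ}

theorem trans_rot_image_tile (s : ℝ) (i : Fin 3) (H : Support) :
    trans (0, rhombusShift s i) '' (rot 7 '' H.tile s) = (step i H).tile s := by
  rw [tile, rot_image_octagon, trans_image_octagon]
  refine octagon_eq_tile fun m => ?_
  rw [step, ZAff.eval_add, dir_shift, sub_ofNat_seven]

theorem rhombus_map_image_tile (hs : s ∈ Icc 0 α) {i : Fin 3}
    (h : H.Le (rhombusAtomSupport i)) :
    (rhombus s).map '' H.tile s = trans (0, rhombusShift s i) '' (rot 7 '' H.tile s) := by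
  rw [image_image]
  exact image_congr fun p hp => rhombus_map_apply hs (h.subset hs hp)

theorem orbitTile_succ {ι : Type} (X : DressedDomain ι) (T : Set Plane) (k : ℕ) :
    orbitTile X T (k + 1) = X.map '' orbitTile X T k := by
  rw [orbitTile, orbitTile, Function.iterate_succ', image_comp]

theorem Follows.orbitTile_eq (h : Follows c H n) (hs : s ∈ Icc 0 α) (hk : k ≤ n) :
    orbitTile (rhombus s) (H.tile s) k = (iter c H k).tile s := by
  induction k with
  | zero => simp [orbitTile, iter]
  | succ k ih =>
    rw [orbitTile_succ, ih (by lia), rhombus_map_image_tile hs (h k hk), trans_rot_image_tile, iter]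

theorem Follows.iterate_mem (h : Follows c H n) (hs : s ∈ Icc 0 α) (hk : k ≤ n) {p : Plane}
    (hp : p ∈ H.tile s) : (rhombus s).map^[k] p ∈ (iter c H k).tile s := by
  rw [← h.orbitTile_eq hs hk]
  exact mem_image_of_mem _ hp

/-- A step permutes the bounds and adds a constant, so iterating from zero bounds accumulates
exactly the translation part of the `k`-th iterate. This gives the map on points, not only on tiles.
-/
theorem Follows.dir_iterate (h : Follows c H n) (hs : s ∈ Icc 0 α) (hk : k ≤ n) {p : Plane}
    (hp : p ∈ H.tile s) (m : Fin 8) :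
    dir m ((rhombus s).map^[k] p) =
      dir ((m + Fin.ofNat 8 k : Fin 8) : ℕ) p + (iter c (fun _ => ⟨0, 0, 0, 0⟩) k m).eval s := by
  induction k generalizing m with
  | zero => simp [iter, ZAff.eval]
  | succ k ih =>
    have hk' := h k hk
    rw [Function.iterate_succ_apply',
      dir_rhombus_map hs (hk'.subset hs (h.iterate_mem hs (by lia) hp)), ih (by lia), iter, step,
      ZAff.eval_add, add_assoc, add_assoc]
    congr 4
    rw [Fin.ext_iff]
    simp [Fin.val_add]
    lia

end Support

/-! ### Area -/

theorem volume_trans_image (d : Plane) (S : Set Plane) : volume (trans d '' S) = volume S := by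
  have : trans d = fun p => p + d := rfl
  rw [this, image_add_right, measure_preimage_add_right]

theorem volume_rot_image (n : ℕ) (S : Set Plane) : volume (rot n '' S) = volume S := by
  set f : Plane →ₗ[ℝ] Plane := Matrix.toLin (Module.Basis.finTwoProd ℝ) (Module.Basis.finTwoProd ℝ)
    !![Real.cos (n * Real.pi / 4), -Real.sin (n * Real.pi / 4);
      Real.sin (n * Real.pi / 4), Real.cos (n * Real.pi / 4)]
  have hf : rot n = f := by
    funext p
    simp only [f, Matrix.toLin_finTwoProd_apply, rot]
    exact Prod.ext (by ring) rfl
  have hdet : LinearMap.det f = 1 := by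
    simp only [f, LinearMap.det_toLin, Matrix.det_fin_two_of]
    linear_combination Real.sin_sq_add_cos_sq (n * Real.pi / 4)
  rw [hf, Measure.addHaar_image_linearMap, hdet]
  simp

/-- The open trapezoid over `(a, b)` between two lines. -/
def trapezoid (a b c₀ c₁ d₀ d₁ : ℝ) : Set Plane :=
  regionBetween (fun x => c₀ + c₁ * x) (fun x => d₀ + d₁ * x) (Ioo a b)

theorem measurableSet_trapezoid (a b c₀ c₁ d₀ d₁ : ℝ) :
    MeasurableSet (trapezoid a b c₀ c₁ d₀ d₁) :=
  measurableSet_regionBetween (by fun_prop) (by fun_prop) measurableSet_Ioo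

theorem mem_trapezoid {a b c₀ c₁ d₀ d₁ : ℝ} {p : Plane} : p ∈ trapezoid a b c₀ c₁ d₀ d₁ ↔
    (a < p.1 ∧ p.1 < b) ∧ c₀ + c₁ * p.1 < p.2 ∧ p.2 < d₀ + d₁ * p.1 := Iff.rfl

theorem disjoint_trapezoid {a b a' b' c₀ c₁ d₀ d₁ c₀' c₁' d₀' d₁' : ℝ} (h : b ≤ a') :
    Disjoint (trapezoid a b c₀ c₁ d₀ d₁) (trapezoid a' b' c₀' c₁' d₀' d₁') := by
  rw [Set.disjoint_left]
  intro p hp hp'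
  rw [mem_trapezoid] at hp hp'
  linarith [hp.1.2, hp'.1.1]

/-- The height is affine in the abscissa: its sign is controlled by the two ends, and the area is
the width times the mean height. -/
theorem volume_trapezoid {a b c₀ c₁ d₀ d₁ : ℝ} (hab : a ≤ b)
    (ha : c₀ + c₁ * a ≤ d₀ + d₁ * a) (hb : c₀ + c₁ * b ≤ d₀ + d₁ * b) :
    volume (trapezoid a b c₀ c₁ d₀ d₁) =
      ENNReal.ofReal ((b - a) * (d₀ - c₀ + (d₁ - c₁) * (a + b) / 2)) := by
  have hint (u v : ℝ) : IntegrableOn (fun x => u + v * x) (Ioo a b) :=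
    ((by fun_prop : Continuous fun x : ℝ => u + v * x).integrableOn_Icc).mono_set
      Ioo_subset_Icc_self
  rw [trapezoid, Measure.volume_eq_prod, volume_regionBetween_eq_integral (hint _ _) (hint _ _)
    measurableSet_Ioo]
  · congr 1
    rw [← integral_Ioc_eq_integral_Ioo, ← intervalIntegral.integral_of_le hab]
    have : ((fun x => d₀ + d₁ * x) - fun x => c₀ + c₁ * x) =
        fun x : ℝ => (d₀ - c₀) + (d₁ - c₁) * x := by
      funext x; simp only [Pi.sub_apply]; ring
    rw [this, intervalIntegral.integral_add (by simp)
      (Continuous.intervalIntegrable (by fun_prop) _ _), intervalIntegral.integral_const,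
      intervalIntegral.integral_const_mul, integral_id, smul_eq_mul]
    ring
  · intro x hx
    rcases hx with ⟨h1, h2⟩
    have hba : 0 < b - a := by linarith
    have : 0 ≤ (b - a) * (d₀ + d₁ * x - (c₀ + c₁ * x)) := by
      have h := add_nonneg (mul_nonneg (sub_nonneg.2 h2.le) (sub_nonneg.2 ha))
        (mul_nonneg (sub_nonneg.2 h1.le) (sub_nonneg.2 hb))
      nlinarith
    linarith [nonneg_of_mul_nonneg_right this hba]

/-- Only lower bounds for tile areas are needed, so it suffices to pack disjoint trapezoids into a
polygon without showing that they exhaust it. -/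
theorem add_le_measure {S A B : Set Plane} {u v : ℝ} (hA : A ⊆ S) (hB : B ⊆ S)
    (hAB : Disjoint A B) (hm : MeasurableSet B) (hu : 0 ≤ u) (hv : 0 ≤ v)
    (hvA : ENNReal.ofReal u ≤ volume A) (hvB : ENNReal.ofReal v ≤ volume B) :
    ENNReal.ofReal (u + v) ≤ volume S := by
  rw [ENNReal.ofReal_add hu hv]
  refine (add_le_add hvA hvB).trans ?_
  rw [← measure_union hAB hm]
  exact measure_mono (union_subset hA hB)

theorem one_lt_α : 1 < α := by nlinarith [α_sq, α_pos]

theorem α_lt_two : α < 2 := by nlinarith [α_sq, α_pos]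

theorem β_eq : β = α - 1 := rfl

theorem ω_eq : ω = α + 1 := rfl

/-! ### Lower bounds for the areas of the model polygons -/

theorem le_volume_Q1 {l : ℝ} (hl : 0 ≤ l) : ENNReal.ofReal (l ^ 2) ≤ volume (Q1 l) := by
  have e : l ^ 2 = l ^ 2 / 2 + l ^ 2 / 2 := by ring
  rw [e]
  refine add_le_measure (A := trapezoid (-l) 0 (-l) 0 0 1) (B := trapezoid 0 l (-l) 0 0 (-1))
    ?_ ?_ (disjoint_trapezoid le_rfl) (measurableSet_trapezoid ..) (by positivity) (by positivity)
    ?_ ?_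
  · intro p hp
    rw [mem_trapezoid] at hp
    rw [Q1_eq_octagon, mem_octagon_cons]
    simp only [Matrix.cons_val, mul_zero, α_mul_α_mul]
    split_ands <;> nlinarith [one_lt_α]
  · intro p hp
    rw [mem_trapezoid] at hp
    rw [Q1_eq_octagon, mem_octagon_cons]
    simp only [Matrix.cons_val, mul_zero, α_mul_α_mul]
    split_ands <;> nlinarith [one_lt_α]
  · rw [volume_trapezoid (by linarith) (by linarith) (by linarith)]
    refine ENNReal.ofReal_le_ofReal (le_of_eq ?_); ring
  · rw [volume_trapezoid (by linarith) (by linarith) (by linarith)]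
    refine ENNReal.ofReal_le_ofReal (le_of_eq ?_); ring

theorem le_volume_Q6 {a b : ℝ} (hb : 0 ≤ b) (hab : b ≤ a) :
    ENNReal.ofReal (2 * a * b - b ^ 2) ≤ volume (Q6 a b) := by
  have e : 2 * a * b - b ^ 2 = b ^ 2 + 2 * b * (a - b) := by ring
  rw [e]
  refine add_le_measure (A := trapezoid 0 b 0 (-1) 0 1) (B := trapezoid b a (-b) 0 b 0)
    ?_ ?_ (disjoint_trapezoid le_rfl) (measurableSet_trapezoid ..) (by positivity)
    (by have := sub_nonneg.2 hab; positivity) ?_ ?_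
  · intro p hp
    rw [mem_trapezoid] at hp
    rw [Q6_eq_octagon, mem_octagon_cons]
    simp only [Matrix.cons_val, mul_zero, α_mul_half_mul]
    split_ands <;> linarith
  · intro p hp
    rw [mem_trapezoid] at hp
    rw [Q6_eq_octagon, mem_octagon_cons]
    simp only [Matrix.cons_val, mul_zero, α_mul_half_mul]
    split_ands <;> linarith
  · rw [volume_trapezoid (by linarith) (by linarith) (by linarith)]
    refine ENNReal.ofReal_le_ofReal (le_of_eq ?_); ring
  · rw [volume_trapezoid (by linarith) (by linarith) (by linarith)]
    refine ENNReal.ofReal_le_ofReal (le_of_eq ?_); ring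

theorem le_volume_Q7 {l : ℝ} (hl : 0 ≤ l) : ENNReal.ofReal (β * l ^ 2) ≤ volume (Q7 l) := by
  have h1 := one_lt_α
  have h2 := α_lt_two
  have hsq := α_sq
  -- The cut is the vertical line through the vertex `(α/2 * l, -(α/2 * l))`, where the edges with
  -- normals `u_5` and `u_7` meet; the summands are the areas on its two sides.
  have e : β * l ^ 2 = l ^ 2 / 4 + (α - 5 / 4) * l ^ 2 := by rw [β_eq]; ring
  have h3 : α / 2 * l ≤ l := by nlinarith
  have h4 : 0 ≤ α / 2 * l := by positivity
  have h5 : l ≤ α * l := by nlinarith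
  rw [e]
  refine add_le_measure (A := trapezoid 0 (α / 2 * l) 0 (-1) 0 0)
    (B := trapezoid (α / 2 * l) l (-(α * l)) 1 0 0)
    ?_ ?_ (disjoint_trapezoid le_rfl) (measurableSet_trapezoid ..) (by positivity)
    (mul_nonneg (by nlinarith) (by positivity)) ?_ ?_
  · intro p hp
    rw [mem_trapezoid] at hp
    rw [Q7_eq_octagon, mem_octagon_cons]
    simp only [Matrix.cons_val, mul_zero, α_mul_half_mul]
    split_ands <;> linarith
  · intro p hp
    rw [mem_trapezoid] at hp
    rw [Q7_eq_octagon, mem_octagon_cons]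
    simp only [Matrix.cons_val, mul_zero, α_mul_half_mul]
    split_ands <;> linarith
  · rw [volume_trapezoid (by linarith) (by linarith) (by linarith)]
    refine ENNReal.ofReal_le_ofReal (le_of_eq ?_)
    linear_combination (-(l ^ 2) / 8) * hsq
  · rw [volume_trapezoid (by linarith) (by linarith) (by linarith)]
    refine ENNReal.ofReal_le_ofReal (le_of_eq ?_)
    linear_combination (3 / 8 * l ^ 2) * hsq

theorem le_volume_Q10 {a b : ℝ} (ha : 0 ≤ a) (hb : 0 ≤ b) :
    ENNReal.ofReal (4 * a * b) ≤ volume (Q10 a b) := by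
  have : trapezoid (-b) b (-a) 0 a 0 ⊆ Q10 a b := by
    intro p hp
    rw [mem_trapezoid] at hp
    rw [Q10_eq_octagon, mem_octagon_cons]
    simp only [Matrix.cons_val, α_mul_half_mul]
    split_ands <;> linarith
  refine le_trans ?_ (measure_mono this)
  rw [volume_trapezoid (by linarith) (by linarith) (by linarith)]
  refine ENNReal.ofReal_le_ofReal (le_of_eq ?_); ring

theorem le_volume_Q5 {l : ℝ} (hl : 0 ≤ l) : ENNReal.ofReal (8 * β * l ^ 2) ≤ volume (Q5 l) := by
  have h1 := one_lt_α
  have h2 := α_lt_two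
  have hsq := α_sq
  have hβ : 0 ≤ β := by rw [β_eq]; linarith
  have hl1 : l ≤ α * l := by nlinarith
  have hl3 : α * l ≤ 2 * l := by nlinarith
  have hβl : β * l = α * l - l := by rw [β_eq]; ring
  -- Left piece, central rectangle, right piece: the octagon has vertices at abscissae `±βl`,
  -- because `tan (π/8) = β`.
  rw [show 8 * β * l ^ 2 = (2 * β * l ^ 2 + 4 * β * l ^ 2) + 2 * β * l ^ 2 by ring]
  have hA : trapezoid (-l) (-(β * l)) (-(α * l)) (-1) (α * l) 1 ⊆ Q5 l := by
    intro p hp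
    rw [mem_trapezoid] at hp
    rw [Q5_eq_octagon, mem_octagon_cons]
    split_ands <;> linarith
  have hB : trapezoid (-(β * l)) (β * l) (-l) 0 l 0 ⊆ Q5 l := by
    intro p hp
    rw [mem_trapezoid] at hp
    rw [Q5_eq_octagon, mem_octagon_cons]
    split_ands <;> linarith
  have hC : trapezoid (β * l) l (-(α * l)) 1 (α * l) (-1) ⊆ Q5 l := by
    intro p hp
    rw [mem_trapezoid] at hp
    rw [Q5_eq_octagon, mem_octagon_cons]
    split_ands <;> linarith
  refine add_le_measure (union_subset hA hB) hC
    (disjoint_union_left.2 ⟨disjoint_trapezoid (by linarith), disjoint_trapezoid le_rfl⟩)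
    (measurableSet_trapezoid ..) (by positivity) (by positivity)
    (add_le_measure subset_union_left subset_union_right (disjoint_trapezoid le_rfl)
      (measurableSet_trapezoid ..) (by positivity) (by positivity) ?_ ?_) ?_
  · rw [volume_trapezoid (by linarith) (by linarith) (by linarith)]
    refine ENNReal.ofReal_le_ofReal (le_of_eq ?_)
    rw [β_eq]
    linear_combination (l ^ 2) * hsq
  · rw [volume_trapezoid (by linarith) (by linarith) (by linarith)]
    refine ENNReal.ofReal_le_ofReal (le_of_eq ?_); ring
  · rw [volume_trapezoid (by linarith) (by linarith) (by linarith)]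
    refine ENNReal.ofReal_le_ofReal (le_of_eq ?_)
    rw [β_eq]
    linear_combination (l ^ 2) * hsq

theorem volume_rhombus_span_le (s : ℝ) :
    volume (rhombus s).span ≤ ENNReal.ofReal (4 * α * ω ^ 2) := by
  have hω : 0 < ω := by rw [ω_eq]; linarith [α_pos]
  have h : 0 ≤ α * ω := by have := α_pos; positivity
  have : (rhombus s).span ⊆ trapezoid (-ω) ω (-(α * ω)) (-1) (α * ω) (-1) := by
    intro p hp
    simp only [rhombus, poly_zero_one_four_five, mem_octagon_cons, Matrix.cons_val] at hp
    rw [mem_trapezoid]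
    split_ands <;> linarith
  refine (measure_mono this).trans (le_of_eq ?_)
  rw [volume_trapezoid (by linarith) (by linarith) (by linarith)]
  congr 1; ring

/-! ### The tiles of the return orbits and of the periodic orbits -/

/-- Bounds of the prototype's atoms after translation onto the first rhombus atom, as confirmed by
`baseAtom_image`. -/
def returnSupport : Fin 5 → Support :=
  ![![⟨1, 1, 0, 0⟩, ⟨-3, 1, -2, 1⟩, ⟨1, -4, 2, -2⟩, ⟨-5, 0, -2, 1⟩,
      ⟨1, -2, 1, -1⟩, ⟨1, 1, 0, 0⟩, ⟨3, 2, 0, 0⟩, ⟨3, 2, 0, 0⟩],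
    ![⟨1, 1, 0, 0⟩, ⟨-1, 0, -1, 0⟩, ⟨-1, -2, 0, -1⟩, ⟨-3, 0, -2, 0⟩,
      ⟨1, -1, 0, -1⟩, ⟨1, 1, 0, 0⟩, ⟨1, 3, -1, 1⟩, ⟨5, 0, 2, -1⟩],
    ![⟨1, 1, 0, 0⟩, ⟨-1, 0, -1, 1⟩, ⟨-1, -2, 2, -1⟩, ⟨-3, 0, -2, 1⟩,
      ⟨1, -1, 1, -1⟩, ⟨1, 1, 0, 0⟩, ⟨1, 2, 0, 1⟩, ⟨3, 1, 1, 0⟩],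
    ![⟨-1, 1, 0, 1⟩, ⟨-1, -1, 0, 1⟩, ⟨-1, -2, 2, -1⟩, ⟨-3, 0, -1, 1⟩,
      ⟨1, -1, 0, 0⟩, ⟨1, 1, 0, 0⟩, ⟨1, 2, -1, 1⟩, ⟨3, 0, 2, -1⟩],
    ![⟨-1, 1, 0, 0⟩, ⟨-1, -1, -1, 1⟩, ⟨-1, -2, 2, -1⟩, ⟨-3, 0, -2, 2⟩,
      ⟨1, -1, 2, -1⟩, ⟨1, 1, 0, 0⟩, ⟨1, 2, 0, 0⟩, ⟨3, 0, 0, 0⟩]]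

def periodicSupport : Fin 3 → Support :=
  ![![⟨-1, 1, -2, 0⟩, ⟨1, 0, -1, 0⟩, ⟨1, 0, 2, -1⟩, ⟨1, 1, -1, 1⟩,
      ⟨1, 1, 0, 0⟩, ⟨1, 0, 1, 0⟩, ⟨-1, 0, 0, 1⟩, ⟨1, -1, 1, -1⟩],
    ![⟨-1, 1, -2, 0⟩, ⟨-1, 1, -2, 0⟩, ⟨1, 0, 0, -1⟩, ⟨-1, 2, -2, 1⟩,
      ⟨1, 1, 0, 0⟩, ⟨1, 1, 0, 0⟩, ⟨-1, 2, -2, 1⟩, ⟨1, 0, 0, -1⟩],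
    ![⟨1, 1, 0, 0⟩, ⟨1, 1, 0, 0⟩, ⟨1, 0, 2, -1⟩, ⟨-1, 0, 0, 1⟩,
      ⟨-1, -1, 2, 0⟩, ⟨-1, -1, 2, 0⟩, ⟨-1, 0, 0, 1⟩, ⟨1, 0, 2, -1⟩]]

/-- The atoms visited by the return orbits. -/
def returnWord : Fin 5 → List (Fin 3) :=
  ![[0, 2, 1, 1, 2, 1, 1, 2, 1, 1, 2, 1, 1, 2], [0, 2, 1, 1, 2], [0, 2, 1, 1, 1, 2], [0, 2, 1, 1, 1, 1, 2], [0, 2, 1, 1, 1, 1, 1, 2]]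

/-- The atoms visited by the periodic orbits. -/
def periodicWord : Fin 3 → List (Fin 3) :=
  ![[1, 2, 1, 1], [1, 2, 1], [1]]

/-- The default value is never relevant: the code is used only below the length of the word. The
same holds for `periodicCode`. -/
def returnCode (j : Fin 5) (k : ℕ) : Fin 3 := (returnWord j).getD k 0

def periodicCode (j : Fin 3) (k : ℕ) : Fin 3 := (periodicWord j).getD k 0

def returnTime (j : Fin 5) : ℕ := (returnWord j).length

def period (j : Fin 3) : ℕ := (periodicWord j).length

/-- The labels of the tiles in all these orbits. -/
abbrev TileIndex : Type := ((j : Fin 5) × Fin (returnTime j)) ⊕ ((k : Fin 3) × Fin (period k))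

def tileSupport : TileIndex → Support :=
  Sum.elim (fun x => Support.iter (returnCode x.1) (returnSupport x.1) x.2)
    (fun x => Support.iter (periodicCode x.1) (periodicSupport x.1) x.2)

/-! ### Finite verification on integer coefficients -/

theorem returnSupport_follows :
    ∀ j, (returnSupport j).Follows (returnCode j) (returnTime j) := by decide +kernel

theorem periodicSupport_follows :
    ∀ j, (periodicSupport j).Follows (periodicCode j) (period j) := by decide +kernel

theorem returnSupport_le : ∀ j, (returnSupport j).Le (rhombusAtomSupport 0) := by decide +kernel

theorem returnSupport_separated :
    ∀ j, ∀ k < returnTime j, 0 < k →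
      (Support.iter (returnCode j) (returnSupport j) k).Separated (rhombusAtomSupport 0) := by
  decide +kernel

theorem iter_returnTime_le :
    ∀ j, (Support.iter (returnCode j) (returnSupport j) (returnTime j)).Le
      (rhombusAtomSupport 0) := by decide +kernel

/-- The tile returns, though its points need not: the rectangle comes back turned by `-π`, the
octagons by multiples of `π/4`, and these are symmetries of the tiles. -/
theorem iter_period :
    ∀ j m, Support.iter (periodicCode j) (periodicSupport j) (period j) m = periodicSupport j m := by
  decide +kernel

theorem tileSupport_le : ∀ x, (tileSupport x).Le rhombusSupport := by decide +kernel

theorem rhombusAtomSupport_le : ∀ i, (rhombusAtomSupport i).Le rhombusSupport := by decide +kernel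

theorem tileSupport_le_atom : ∀ x, ∃ i, (tileSupport x).Le (rhombusAtomSupport i) := by
  decide +kernel

theorem rhombusAtomSupport_le_self : ∀ i, (rhombusAtomSupport i).Le (rhombusAtomSupport i) := by
  decide +kernel

/-- Restricts the covering of the rhombus to a covering of its first atom: every orbit tile other
than the starting ones misses that atom. -/
theorem eq_returnSupport_of_not_separated : ∀ x,
    ¬(tileSupport x).Separated (rhombusAtomSupport 0) → ∃ j, tileSupport x = returnSupport j := by
  decide +kernel

theorem tileSupport_separated :
    ∀ x y, x ≠ y → (tileSupport x).Separated (tileSupport y) := by decide +kernel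

theorem card_returnCode_eq :
    ∀ j i, ((Finset.range (returnTime j)).filter fun k => returnCode j k = i).card =
      incidence i j := by decide +kernel

/-- `returnX` and `returnY` are the translation parts of the return isometries; `returnRot` is minus
the return time modulo 8, as each step turns by `-π/4`. -/
def returnX : Fin 5 → ZAff := ![⟨0, -3, 0, -1⟩,
      ⟨0, 0, -2, 0⟩, ⟨0, -1, 0, -1⟩, ⟨-2, 1, -2, 1⟩, ⟨2, 0, 0, 0⟩]

def returnY : Fin 5 → ZAff := ![⟨-2, -3, 2, -1⟩,
      ⟨-6, -2, 0, 0⟩, ⟨-2, -3, 2, -1⟩, ⟨-2, -1, 2, -1⟩, ⟨-2, 0, 0, 0⟩]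

def returnRot : Fin 5 → Fin 8 := ![2, 3, 2, 1, 0]

theorem iter_zero_returnTime :
    ∀ j, Support.iter (returnCode j) (fun _ => ⟨0, 0, 0, 0⟩) (returnTime j) 0 = returnX j ∧
      Support.iter (returnCode j) (fun _ => ⟨0, 0, 0, 0⟩) (returnTime j) 2 = returnY j := by
  decide +kernel

theorem rhombusAtomSupport_step_le :
    ∀ i, (Support.step i (rhombusAtomSupport i)).Le rhombusSupport := by decide +kernel

/-! ### Placement of the base triangle and of the periodic tiles -/

theorem rot_zero (p : Plane) : rot 0 p = p := by simp [rot]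

theorem rot_one (p : Plane) : rot 1 p = (α / 2 * (p.1 - p.2), α / 2 * (p.1 + p.2)) := by
  simp only [rot, Nat.cast_one, one_mul, Real.cos_pi_div_four, Real.sin_pi_div_four, α]
  ext <;> (simp only; ring)

theorem rot_two (p : Plane) : rot 2 p = (-p.2, p.1) := by
  have h : ((2 : ℕ) : ℝ) * Real.pi / 4 = Real.pi / 2 := by push_cast; ring
  simp only [rot, h, Real.cos_pi_div_two, Real.sin_pi_div_two]
  ext <;> (simp only; ring)

theorem rot_three (p : Plane) : rot 3 p = (-(α / 2 * (p.1 + p.2)), α / 2 * (p.1 - p.2)) := by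
  have h : ((3 : ℕ) : ℝ) * Real.pi / 4 = Real.pi / 4 + Real.pi / 2 := by push_cast; ring
  simp only [rot, h, Real.cos_add_pi_div_two, Real.sin_add_pi_div_two, Real.cos_pi_div_four,
    Real.sin_pi_div_four, α]
  ext <;> (simp only; ring)

theorem rot_trans (n : ℕ) (d p : Plane) : rot n (trans d p) = trans (rot n d) (rot n p) := by
  simp only [rot, trans]
  ext <;> (simp only; ring)

theorem trans_trans (d e p : Plane) : trans d (trans e p) = trans (d + e) p := by
  simp only [trans, Prod.fst_add, Prod.snd_add]
  ext <;> (simp only; ring)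

theorem trans_rot_image_octagon (d : Plane) (n : ℕ) (h : Fin 8 → ℝ) :
    (fun p => trans d (rot n p)) '' octagon h =
      octagon fun m => h (m - Fin.ofNat 8 n) + dir m d := by
  rw [← trans_image_octagon, ← rot_image_octagon, image_image]

/-- The translation which carries the prototype base triangle to the first atom of the rhombus. -/
def baseMotion : OctMotion := ⟨false, 0, ⟨1, 1, 0, 0⟩, ⟨-1, -2, 2, -1⟩⟩

def baseShift (s : ℝ) : Plane := (baseMotion.d₁.eval s, baseMotion.d₂.eval s)

theorem baseMotion_act (s : ℝ) (p : Plane) : baseMotion.act s p = trans (baseShift s) p := by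
  change trans _ (rot 0 p) = _
  rw [rot_zero]
  rfl

theorem baseMotion_act_eq (s : ℝ) : baseMotion.act s = trans (baseShift s) :=
  funext (baseMotion_act s)

theorem baseTriangle_span_image (s : ℝ) :
    baseMotion.act s '' (baseTriangle 1 s).span = (rhombusAtomSupport 0).tile s := by
  have h := α_sq
  simp only [baseTriangle, baseMotion_act_eq, Q1_eq_octagon, rot_image_octagon, trans_image_octagon]
  refine Support.octagon_eq_tile fun m => ?_
  rw [β_eq]
  fin_cases m <;>
    simp [dir_zero, dir_one, dir_two, dir_three, dir_four, dir_five, dir_six, dir_seven,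
      rhombusAtomSupport, ZAff.eval, SMod.eval, baseShift, baseMotion] <;> grind

theorem baseAtom_image (s : ℝ) (j : Fin 5) :
    baseMotion.act s '' baseAtom 1 s j = (returnSupport j).tile s := by
  have h := α_sq
  rw [baseMotion_act_eq, baseAtom]
  fin_cases j <;>
  simp only [Fin.zero_eta, Fin.mk_one, Fin.reduceFinMk, baseShape, basePlaceRot, baseAnchor,
    Matrix.cons_val, Q1_eq_octagon, Q6_eq_octagon, Q7_eq_octagon, trans_rot_image_octagon,
    trans_image_octagon, β_eq] <;>
  refine Support.octagon_eq_tile fun m => ?_ <;>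
  fin_cases m <;>
    simp [dir_zero, dir_one, dir_two, dir_three, dir_four, dir_five, dir_six, dir_seven,
      returnSupport, ZAff.eval, SMod.eval, baseShift, baseMotion] <;> grind

theorem periodicTile_eq (s : ℝ) (j : Fin 3) :
    periodicTile s j = (periodicSupport j).tile s := by
  have h := α_sq
  fin_cases j <;>
  simp only [Fin.zero_eta, Fin.mk_one, Fin.reduceFinMk, periodicTile, Matrix.cons_val,
    Q5_eq_octagon, Q10_eq_octagon, trans_image_octagon] <;>
  refine Support.octagon_eq_tile fun m => ?_ <;> simp only [β_eq, ω_eq] <;>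
  fin_cases m <;>
    simp [dir_zero, dir_one, dir_two, dir_three, dir_four, dir_five, dir_six, dir_seven,
      periodicSupport, ZAff.eval] <;> grind

/-- Equality of the translation parts in the conjugacy: the prototype map followed by the placement
agrees with the placement followed by the return isometry. -/
theorem baseShift_add_eq (s : ℝ) (j : Fin 5) :
    baseShift s + (U1 (baseAnchor 1 s j) - rot (baseMapRot j) (baseAnchor 1 s j)) =
      ((returnX j).eval s, (returnY j).eval s) + rot (baseMapRot j) (baseShift s) := by
  have h := α_sq
  fin_cases j <;>
  simp only [Fin.zero_eta, Fin.mk_one, Fin.reduceFinMk, baseAnchor, baseMapRot, returnX, returnY,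
    Matrix.cons_val, rot_zero, rot_one, rot_two, rot_three, U1, baseShift, baseMotion, β_eq] <;>
  ext <;>
  simp [SMod.eval, ZAff.eval] <;> grind

/-! ### Areas of the orbit tiles -/

/-- A step is the image under an isometry whether or not the tile lies in the atom, so no itinerary
hypothesis is required. -/
theorem volume_iter_tile (s : ℝ) (c : ℕ → Fin 3) (H : Support) (k : ℕ) :
    volume ((Support.iter c H k).tile s) = volume (H.tile s) := by
  induction k with
  | zero => rfl
  | succ k ih =>
    rw [Support.iter, ← Support.trans_rot_image_tile, volume_trans_image, volume_rot_image,
      ih]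

def returnArea (s : ℝ) : Fin 5 → ℝ :=
  ![(α * β - β * s) ^ 2, β * (2 - α * s) ^ 2, 2 * (2 - β * s) * s - s ^ 2, β * (α * s) ^ 2,
    (β * s) ^ 2]

def periodicArea (s : ℝ) : Fin 3 → ℝ :=
  ![4 * s * (α - s), 8 * β * (α - s) ^ 2, 8 * β * s ^ 2]

theorem β_pos : 0 < β := by rw [β_eq]; linarith [one_lt_α]

theorem returnArea_nonneg {s : ℝ} (hs : s ∈ Icc 0 α) (j : Fin 5) : 0 ≤ returnArea s j := by
  obtain ⟨h0, h1⟩ := hs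
  have hβ := β_pos
  have hα := α_lt_two
  fin_cases j <;> simp only [Fin.zero_eta, Fin.mk_one, Fin.reduceFinMk, returnArea, Matrix.cons_val]
  · positivity
  · positivity
  · rw [β_eq]
    nlinarith [α_sq, mul_nonneg h0 (sub_nonneg.2 h1)]
  · positivity
  · positivity

theorem periodicArea_nonneg {s : ℝ} (hs : s ∈ Icc 0 α) (j : Fin 3) : 0 ≤ periodicArea s j := by
  obtain ⟨h0, h1⟩ := hs
  have hβ := β_pos
  have h1' := sub_nonneg.2 h1
  fin_cases j <;>
    simp only [Fin.zero_eta, Fin.mk_one, Fin.reduceFinMk, periodicArea, Matrix.cons_val] <;>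
    positivity

theorem le_volume_returnSupport {s : ℝ} (hs : s ∈ Icc 0 α) (j : Fin 5) :
    ENNReal.ofReal (returnArea s j) ≤ volume ((returnSupport j).tile s) := by
  obtain ⟨h0, h1⟩ := hs
  have hβ := β_pos
  have hα := α_pos
  have hsq := α_sq
  rw [← baseAtom_image, baseMotion_act_eq, volume_trans_image, baseAtom,
    ← image_image (trans (baseAnchor 1 s j)), volume_trans_image, volume_rot_image]
  fin_cases j <;>
    simp only [Fin.zero_eta, Fin.mk_one, Fin.reduceFinMk, returnArea, baseShape, Matrix.cons_val,
      mul_one]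
  · exact le_volume_Q1 (by nlinarith)
  · exact le_volume_Q7 (by nlinarith)
  -- The condition `s ≤ 2 - βs` amounts to `αs ≤ 2`, that is `s ≤ α`.
  · exact le_volume_Q6 h0 (by rw [β_eq]; nlinarith)
  · exact le_volume_Q7 (by positivity)
  · exact le_volume_Q1 (by positivity)

theorem le_volume_periodicSupport {s : ℝ} (hs : s ∈ Icc 0 α) (j : Fin 3) :
    ENNReal.ofReal (periodicArea s j) ≤ volume ((periodicSupport j).tile s) := by
  obtain ⟨h0, h1⟩ := hs
  have h1' := sub_nonneg.2 h1
  rw [← periodicTile_eq]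
  fin_cases j <;>
    simp only [Fin.zero_eta, Fin.mk_one, Fin.reduceFinMk, periodicArea, periodicTile,
      Matrix.cons_val, volume_trans_image]
  · exact le_volume_Q10 h0 h1'
  · exact le_volume_Q5 h1'
  · exact le_volume_Q5 h0

/-- Disjoint tiles inside a set of finite area exhaust it up to measure zero once their total area
is at least that of the set. -/
theorem tileSupport_cover {s : ℝ} (hs : s ∈ Icc 0 α) :
    volume ((rhombus s).span \ ⋃ x, (tileSupport x).tile s) = 0 := by
  have hsub : ⋃ x, (tileSupport x).tile s ⊆ (rhombus s).span := by
    rw [rhombus_span]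
    exact iUnion_subset fun x => (tileSupport_le x).subset hs
  have hle := volume_rhombus_span_le s
  have hfin : volume (rhombus s).span ≠ ⊤ := (hle.trans_lt ENNReal.ofReal_lt_top).ne
  have hopen x : IsOpen ((tileSupport x).tile s) := (tileSupport x).isOpen_tile s
  rw [measure_sdiff hsub (isOpen_iUnion hopen).nullMeasurableSet
    (ne_top_of_le_ne_top hfin (measure_mono hsub)), tsub_eq_zero_iff_le,
    measure_iUnion (fun x y hxy => (tileSupport_separated x y hxy).disjoint hs)
      fun x => (hopen x).measurableSet, tsum_fintype]
  let area : TileIndex → ℝ := Sum.elim (fun x => returnArea s x.1) (fun x => periodicArea s x.1)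
  -- Each area is weighted by its orbit length; the dependence on `s` cancels.
  have harea : ∑ x, area x = 4 * α * ω ^ 2 := by
    have h := α_sq
    rw [Fintype.sum_sum_type, Fintype.sum_sigma, Fintype.sum_sigma]
    simp only [area, Sum.elim_inl, Sum.elim_inr, Finset.sum_const, Finset.card_univ,
      Fintype.card_fin, nsmul_eq_mul]
    simp [Fin.sum_univ_succ, returnTime, period, returnWord, periodicWord, returnArea,
      periodicArea, β_eq, ω_eq]
    grind
  have hnonneg x : 0 ≤ area x := by
    rcases x with x | x
    · exact returnArea_nonneg hs x.1
    · exact periodicArea_nonneg hs x.1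
  calc volume (rhombus s).span ≤ ENNReal.ofReal (∑ x, area x) := harea ▸ hle
    _ = ∑ x, ENNReal.ofReal (area x) := ENNReal.ofReal_sum_of_nonneg fun x _ => hnonneg x
    _ ≤ ∑ x, volume ((tileSupport x).tile s) := Finset.sum_le_sum fun x _ => ?_
  rcases x with x | x
  · change _ ≤ volume ((Support.iter _ _ _).tile s)
    rw [volume_iter_tile]
    exact le_volume_returnSupport hs x.1
  · change _ ≤ volume ((Support.iter _ _ _).tile s)
    rw [volume_iter_tile]
    exact le_volume_periodicSupport hs x.1

/-! ### Dressed domains -/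

/-- An open null set is empty, so `U` is dense in `D`; convexity keeps the interior of the closure
from exceeding the open set `D`. -/
theorem eq_interior_closure_of_volume_eq_zero {D U : Set Plane} (hD : IsOpen D)
    (hconv : Convex ℝ D) (hU : U ⊆ D) (h : volume (D \ U) = 0) : D = interior (closure U) := by
  have hsub : D ⊆ closure U := by
    have hopen : IsOpen (D \ closure U) := hD.sdiff isClosed_closure
    have hnull : volume (D \ closure U) = 0 :=
      measure_mono_null (sdiff_subset_sdiff_right subset_closure) h
    exact sdiff_eq_empty.1 (hopen.measure_eq_zero_iff volume |>.1 hnull)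
  refine (interior_maximal hsub hD).antisymm ?_
  rcases D.eq_empty_or_nonempty with rfl | hne
  · simp [subset_empty_iff.1 hU]
  · refine (interior_mono (closure_mono hU)).trans ?_
    rw [hconv.interior_closure_eq_interior_of_nonempty_interior (by rwa [hD.interior_eq]),
      hD.interior_eq]

/-- The first atom of the rhombus, dressed by the translated base triangle. -/
def returnTriangle (s : ℝ) : DressedDomain (Fin 5) where
  span := baseMotion.act s '' (baseTriangle 1 s).span
  atom j := baseMotion.act s '' (baseTriangle 1 s).atom j
  map p := baseMotion.act s ((baseTriangle 1 s).map (p - baseShift s))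

theorem baseMotion_act_sub (s : ℝ) (p : Plane) : baseMotion.act s p - baseShift s = p := by
  rw [baseMotion_act]
  exact add_sub_cancel_right p _

theorem returnTriangle_map_act (s : ℝ) (p : Plane) :
    (returnTriangle s).map (baseMotion.act s p) =
      baseMotion.act s ((baseTriangle 1 s).map p) := by
  simp only [returnTriangle, baseMotion_act_sub]

theorem returnTriangle_span (s : ℝ) :
    (returnTriangle s).span = (rhombusAtomSupport 0).tile s := baseTriangle_span_image s

theorem returnTriangle_atom (s : ℝ) (j : Fin 5) :
    (returnTriangle s).atom j = (returnSupport j).tile s := baseAtom_image s j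

theorem rhombus_atom (s : ℝ) (i : Fin 3) :
    (rhombus s).atom i = (rhombusAtomSupport i).tile s := rhombusAtom_eq s i

theorem returnSupport_eq_tileSupport (j : Fin 5) (h : 0 < returnTime j) :
    returnSupport j = tileSupport (.inl ⟨j, ⟨0, h⟩⟩) := rfl

theorem returnTime_pos : ∀ j, 0 < returnTime j := by decide

theorem period_pos : ∀ j, 0 < period j := by decide

theorem returnSupport_disjoint {s : ℝ} (hs : s ∈ Icc 0 α) :
    Pairwise fun i j => Disjoint ((returnSupport i).tile s) ((returnSupport j).tile s) := by
  intro i j hij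
  rw [returnSupport_eq_tileSupport i (returnTime_pos i),
    returnSupport_eq_tileSupport j (returnTime_pos j)]
  refine (tileSupport_separated _ _ fun h => hij ?_).disjoint hs
  exact congrArg Sigma.fst (Sum.inl_injective h)

theorem baseAtom_disjoint {s : ℝ} (hs : s ∈ Icc 0 α) :
    Pairwise fun i j => Disjoint (baseAtom 1 s i) (baseAtom 1 s j) := by
  intro i j hij
  refine Set.disjoint_left.2 fun p hi hj => ?_
  have hd := returnSupport_disjoint hs hij
  simp only [← baseAtom_image] at hd
  exact Set.disjoint_left.1 hd (mem_image_of_mem _ hi) (mem_image_of_mem _ hj)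

theorem returnRot_eq : ∀ j, baseMapRot j = returnRot j := by decide

theorem add_returnTime_eq_sub_returnRot :
    ∀ (j : Fin 5) (m : Fin 8), m + Fin.ofNat 8 (returnTime j) = m - Fin.ofNat 8 (returnRot j) := by
  decide

theorem iterate_returnTime {s : ℝ} (hs : s ∈ Icc 0 α) {j : Fin 5} {p : Plane}
    (hp : p ∈ (returnSupport j).tile s) :
    (rhombus s).map^[returnTime j] p =
      trans ((returnX j).eval s, (returnY j).eval s) (rot (returnRot j) p) := by
  have h m := (returnSupport_follows j).dir_iterate hs le_rfl hp m
  obtain ⟨hx, hy⟩ := iter_zero_returnTime j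
  -- The coordinates `0` and `2` are the Cartesian ones, hence determine the point.
  have h0 := h 0
  have h2 := h 2
  rw [hx, add_returnTime_eq_sub_returnRot, ← dir_val_rot] at h0
  rw [hy, add_returnTime_eq_sub_returnRot, ← dir_val_rot] at h2
  simp only [Fin.val_zero, Fin.val_two, dir_zero, dir_two] at h0 h2
  exact Prod.ext h0 h2

theorem returnTriangle_map {s : ℝ} (hs : s ∈ Icc 0 α) {j : Fin 5} {p : Plane}
    (hp : p ∈ (returnSupport j).tile s) :
    (returnTriangle s).map p = (rhombus s).map^[returnTime j] p := by
  rw [iterate_returnTime hs hp]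
  rw [← baseAtom_image] at hp
  obtain ⟨q, hq, rfl⟩ := hp
  have hglue : (baseTriangle 1 s).map q = baseIso 1 s j q :=
    glue_apply (baseIso 1 s) (baseAtom_disjoint hs) hq
  rw [returnTriangle_map_act, hglue, baseMotion_act, baseMotion_act, baseIso, trans_trans,
    rot_trans, trans_trans, baseShift_add_eq, returnRot_eq]

theorem isDressedDomain_rhombus {s : ℝ} (hs : s ∈ Icc 0 α) : IsDressedDomain s (rhombus s) := by
  refine ⟨fun i => ?_, rhombusAtom_disjoint hs, ?_, fun i => ?_, fun i => ?_⟩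
  · rw [rhombus_atom]
    exact Support.isTile _ _
  · refine eq_interior_closure_of_volume_eq_zero ?_ ?_ ?_ ?_
    · rw [rhombus_span]
      exact Support.isOpen_tile _ _
    · rw [rhombus_span]
      exact convex_octagon _
    · refine iUnion_subset fun i => ?_
      rw [rhombus_atom, rhombus_span]
      exact (rhombusAtomSupport_le i).subset hs
    -- Every orbit tile lies in an atom, so the atoms cover whatever the orbit tiles cover.
    · refine measure_mono_null (sdiff_subset_sdiff_right (iUnion_subset fun x => ?_))
        (tileSupport_cover hs)
      obtain ⟨i, hi⟩ := tileSupport_le_atom x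
      refine (hi.subset hs).trans ?_
      rw [← rhombus_atom]
      exact subset_iUnion (rhombus s).atom i
  · refine ⟨⟨false, 7, ⟨0, 0, 0, 0⟩, (shiftSupport i 2).toSMod⟩, rfl, fun p hp => ?_⟩
    rw [rhombus_atom] at hp
    rw [rhombus_map_apply hs hp]
    have h := dir_shift s i 2
    simp only [Fin.val_two, dir_two] at h
    have h0 : (⟨0, 0, 0, 0⟩ : SMod).eval s = 0 := by simp [SMod.eval]
    simp [OctMotion.act, ZAff.eval_toSMod, h0, h]
  · rw [mapsTo_iff_image_subset, rhombus_atom, Support.rhombus_map_image_tile hs fun m => ?_,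
      Support.trans_rot_image_tile, rhombus_span]
    · exact (rhombusAtomSupport_step_le i).subset hs
    · exact rhombusAtomSupport_le_self i m

theorem isDressedDomain_returnTriangle {s : ℝ} (hs : s ∈ Icc 0 α) :
    IsDressedDomain s (returnTriangle s) := by
  refine ⟨fun j => ?_, fun i j hij => ?_, ?_, fun j => ?_, fun j => ?_⟩
  · rw [returnTriangle_atom]
    exact Support.isTile _ _
  · simp only [returnTriangle_atom]
    exact returnSupport_disjoint hs hij
  · rw [returnTriangle_span]
    refine eq_interior_closure_of_volume_eq_zero (Support.isOpen_tile _ _) (convex_octagon _)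
      (iUnion_subset fun j => ?_) (measure_mono_null ?_ (tileSupport_cover hs))
    · rw [returnTriangle_atom]
      exact (returnSupport_le j).subset hs
    · rintro p ⟨hp, hpU⟩
      refine ⟨?_, fun hmem => hpU ?_⟩
      · rw [rhombus_span]
        exact (rhombusAtomSupport_le 0).subset hs hp
      · obtain ⟨x, hx⟩ := mem_iUnion.1 hmem
        by_cases hsep : (tileSupport x).Separated (rhombusAtomSupport 0)
        · exact absurd hp (Set.disjoint_left.1 (hsep.disjoint hs) hx)
        · obtain ⟨j, hj⟩ := eq_returnSupport_of_not_separated x hsep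
          rw [mem_iUnion]
          exact ⟨j, by rwa [returnTriangle_atom, ← hj]⟩
  · refine ⟨⟨false, returnRot j, (returnX j).toSMod, (returnY j).toSMod⟩, rfl, fun p hp => ?_⟩
    rw [returnTriangle_atom] at hp
    rw [returnTriangle_map hs hp, iterate_returnTime hs hp]
    simp [OctMotion.act, ZAff.eval_toSMod]
  · intro p hp
    rw [returnTriangle_atom] at hp
    rw [returnTriangle_map hs hp, returnTriangle_span]
    exact (iter_returnTime_le j).subset hs
      ((returnSupport_follows j).iterate_mem hs le_rfl hp)

theorem isDressedSubdomain_returnTriangle {s : ℝ} (hs : s ∈ Icc 0 α) :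
    IsDressedSubdomain s (rhombus s) (returnTriangle s) := by
  refine ⟨isDressedDomain_rhombus hs, isDressedDomain_returnTriangle hs, ?_, fun j p hp => ?_⟩
  · rw [returnTriangle_span, rhombus_span]
    exact (rhombusAtomSupport_le 0).subset hs
  · rw [returnTriangle_atom] at hp
    have hmem {k : ℕ} (hk : k ≤ returnTime j) :=
      (returnSupport_follows j).iterate_mem hs hk hp
    refine ⟨returnTime j, ⟨returnTime_pos j, fun k hk => ?_, fun k hk0 hk => ?_, ?_⟩,
      returnTriangle_map hs hp⟩
    · refine mem_iUnion.2 ⟨returnCode j k, ?_⟩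
      rw [rhombus_atom]
      exact (returnSupport_follows j k hk).subset hs (hmem hk.le)
    · rw [returnTriangle_span]
      exact Set.disjoint_left.1 ((returnSupport_separated j k hk hk0).disjoint hs) (hmem hk.le)
    · rw [returnTriangle_span]
      exact (iter_returnTime_le j).subset hs (hmem le_rfl)

/-! ### Orbits of tiles -/

theorem Support.Follows.staysInAtoms {s : ℝ} (hs : s ∈ Icc 0 α) {c : ℕ → Fin 3} {H : Support}
    {n : ℕ} (h : H.Follows c n) : StaysInAtoms (rhombus s) (H.tile s) n := by
  intro k hk
  refine ⟨c k, ?_⟩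
  rw [h.orbitTile_eq hs hk.le, rhombus_atom]
  exact (h k hk).subset hs

theorem isReturnOrbit_returnTriangle {s : ℝ} (hs : s ∈ Icc 0 α) (j : Fin 5) :
    IsReturnOrbit (rhombus s) ((rhombus s).atom 0) ((returnTriangle s).atom j) (returnTime j) := by
  have h := returnSupport_follows j
  rw [returnTriangle_atom, rhombus_atom]
  refine ⟨returnTime_pos j, (returnSupport_le j).subset hs, h.staysInAtoms hs,
    fun k hk0 hk => ?_, ?_⟩
  · rw [h.orbitTile_eq hs hk.le]
    exact (returnSupport_separated j k hk hk0).disjoint hs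
  · rw [h.orbitTile_eq hs le_rfl]
    exact (iter_returnTime_le j).subset hs

theorem isPeriodicOrbit_periodicTile {s : ℝ} (hs : s ∈ Icc 0 α) (k : Fin 3) :
    IsPeriodicOrbit (rhombus s) (periodicTile s k) (period k) := by
  have h := periodicSupport_follows k
  rw [periodicTile_eq]
  refine ⟨period_pos k, h.staysInAtoms hs, ?_⟩
  rw [h.orbitTile_eq hs le_rfl, funext (iter_period k)]

/-- Nonemptiness matters: an empty tile lies in every atom and would be counted each time. A
nonempty one lies in only one of the disjoint atoms. -/
theorem Support.Follows.visits_eq {s : ℝ} (hs : s ∈ Icc 0 α) {c : ℕ → Fin 3} {H : Support} {n : ℕ}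
    (h : H.Follows c n) (hne : (H.tile s).Nonempty) (i : Fin 3) :
    visits (rhombus s) (H.tile s) n i = ((Finset.range n).filter fun k => c k = i).card := by
  rw [visits, ← Set.ncard_coe_finset]
  congr 1
  ext k
  simp only [mem_ofPred_eq, Finset.coe_filter, Finset.mem_range]
  refine and_congr_right fun hk => ⟨fun hsub => ?_, ?_⟩
  · by_contra hci
    obtain ⟨p, hp⟩ := hne
    refine Set.disjoint_left.1 (rhombusAtom_disjoint hs hci) ?_ (hsub (mem_image_of_mem _ hp))
    rw [rhombusAtom_eq]
    exact (h k hk).subset hs (h.iterate_mem hs hk.le hp)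
  · rintro rfl
    rw [h.orbitTile_eq hs hk.le, rhombus_atom]
    exact (h k hk).subset hs

theorem tilesUpToNull_rhombus {s : ℝ} (hs : s ∈ Icc 0 α) :
    TilesUpToNull
      (Sum.elim
        (fun x : (j : Fin 5) × Fin (returnTime j) =>
          orbitTile (rhombus s) ((returnTriangle s).atom x.1) x.2)
        (fun x : (k : Fin 3) × Fin (period k) =>
          orbitTile (rhombus s) (periodicTile s x.1) x.2))
      (rhombus s).span := by
  have key : (Sum.elim
        (fun x : (j : Fin 5) × Fin (returnTime j) =>
          orbitTile (rhombus s) ((returnTriangle s).atom x.1) x.2)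
        (fun x : (k : Fin 3) × Fin (period k) =>
          orbitTile (rhombus s) (periodicTile s x.1) x.2)) =
      fun x => (tileSupport x).tile s := by
    funext x
    rcases x with x | x
    · rw [Sum.elim_inl, returnTriangle_atom,
        (returnSupport_follows x.1).orbitTile_eq hs x.2.2.le]
      rfl
    · rw [Sum.elim_inr, periodicTile_eq,
        (periodicSupport_follows x.1).orbitTile_eq hs x.2.2.le]
      rfl
  rw [key]
  refine ⟨fun x y hxy => (tileSupport_separated x y hxy).disjoint hs, fun x => ?_,
    tileSupport_cover hs⟩
  rw [rhombus_span]
  exact (tileSupport_le x).subset hs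

end RhombusPWI

end

open RhombusPWI
theorem proposition1 :
    ∃ B : ℝ → DressedDomain (Fin 5),
      ParamCongruent (Set.Icc 0 RhombusPWI.α) (fun s => baseTriangle 1 s) B ∧
      ∀ s ∈ Set.Icc 0 RhombusPWI.α,
        (B s).span = (rhombus s).atom 0 ∧
        IsDressedSubdomain s (rhombus s) (B s) ∧
        ∃ (N : Fin 5 → ℕ) (p : Fin 3 → ℕ),
          (∀ j, IsReturnOrbit (rhombus s) ((rhombus s).atom 0) ((B s).atom j) (N j)) ∧
          (∀ k, IsPeriodicOrbit (rhombus s) (periodicTile s k) (p k)) ∧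
          TilesUpToNull
            (Sum.elim
              (fun x : (j : Fin 5) × Fin (N j) => orbitTile (rhombus s) ((B s).atom x.1) x.2)
              (fun x : (k : Fin 3) × Fin (p k) => orbitTile (rhombus s) (periodicTile s x.1) x.2))
            (rhombus s).span ∧
          (∀ j, ((B s).atom j).Nonempty →
            ∀ i, visits (rhombus s) ((B s).atom j) (N j) i = incidence i j) := by
  refine ⟨returnTriangle, ⟨baseMotion, fun s _ => ⟨rfl, fun j => ⟨rfl, fun p _ =>
    returnTriangle_map_act s p⟩⟩⟩, fun s hs => ⟨?_, isDressedSubdomain_returnTriangle hs,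
    returnTime, period, isReturnOrbit_returnTriangle hs, isPeriodicOrbit_periodicTile hs,
    tilesUpToNull_rhombus hs, fun j hne i => ?_⟩⟩
  · rw [returnTriangle_span, rhombus_atom]
  · rw [returnTriangle_atom] at hne ⊢
    rw [(returnSupport_follows j).visits_eq hs hne, card_returnCode_eq]
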